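/- **Darboux transformation of the position vector.** Let $K\in\{0,1,-1\}$, let $R_{2n+1}(K)$ be $\mathbf R^{2n+1}$ with inner product $x_1y_1+\dots+x_{2n}y_{2n}+x_{2n+1}y_{2n+1}$ for $K=0,1$ and $x_1y_1+\dots+x_{2n}y_{2n}-x_{2n+1}y_{2n+1}$ for $K=-1$, and let $M_{2n}(K)\subset R_{2n+1}(K)$ be $\{x_{2n+1}=0\}$ for $K=0$ and $\{x\cdot x=K\}$ for $K=\pm1$. Let $U\subset\mathbf R^n$ be open; all functions below are smooth on $U$, and $\partial_i=\partial/\partial x_i$. Consider the following equations. * (GC), for real functions $\rho_i$ (possibly with zeros) and $\gamma_{ij}$ with $\gamma_{ii}=0$: for $i\ne j$, $\partial_i\gamma_{ij}+\partial_j\gamma_{ji}=\sum_{l\ne i,j}\gamma_{li}\gamma_{lj}$; $\partial_k\gamma_{ij}+\gamma_{ik}\gamma_{kj}=0$ for $k\neq i,j$; $\partial_i\gamma_{ji}+\partial_j\gamma_{ij}-\sum_{l\ne i,j}\gamma_{il}\gamma_{jl}-K\rho_i\rho_j=0$; $\partial_j\rho_i+\gamma_{ij}\rho_j=0$. * ($\Omega$),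 for $\omega=(\omega_{i\alpha}):U\to O(n)$: $\partial_j\omega_{i\alpha}+\gamma_{ij}\omega_{j\alpha}=0$ $(i\ne j)$, $\partial_i\omega_{i\alpha}=\sum_{k\ne i}\gamma_{ki}\omega_{k\alpha}$. * (L$_\lambda$), for $(u_i,v_i,w)$: $\partial_iu_i=\sum_{k\ne i}\gamma_{ki}u_k-\lambda v_i$, $\partial_ju_i=-\gamma_{ij}u_j$, $\partial_iv_i=\sum_{k\ne i}\gamma_{ik}v_k+\lambda u_i-K\rho_iw$, $\partial_jv_i=-\gamma_{ji}v_j$ $(i\neq j)$, $\partial_iw=\rho_iv_i$. A *frame* for $(\rho,\gamma)$ consists of $\vec p_i,\vec q_i,\vec r:U\to R_{2n+1}(K)$ $(1\le i\le n)$ such that $\vec r\in M_{2n}(K)$, the vectors $\vec p_1,\dots,\vec p_n,\vec q_1,\dots,\vec q_n$ are an orthonormal basis of $T_{\vec r}M_{2n}(K)$, and $(\vec p_i,\vec q_i,\vec r)$ solves (L$_1$) (the structure equations). (a) Let $\vec V:U\to M_{2n}(K)$ be an immersion with parallel orthonormal normal fields $\vec n_1,\dots,\vec n_n$, first fundamental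 form $\sum_i\rho_i^2dx_i^2$ $(\rho_i\ne0)$ and second fundamental form $\sum_{i,\alpha}\rho_i\omega_{i\alpha}dx_i^2\,\vec n_\alpha$, $\omega\in O(n)$. Put $\gamma_{ij}=-\partial_j\rho_i/\rho_j$ $(i\ne j)$, $\gamma_{ii}=0$, $\vec p_i=\sum_\alpha\omega_{i\alpha}\vec n_\alpha$, $\vec q_i=\rho_i^{-1}\partial_i\vec V$, $\vec r=\vec V$. Then (GC) and ($\Omega$) hold and $(\vec p,\vec q,\vec r)$ is a frame for $(\rho,\gamma)$. (b) Let $(\rho,\gamma)$ solve (GC), let $\mu\in\mathbf R$, and let $\xi_i,\eta_i,\zeta$ be real functions such that $H=(\xi_1,\dots,\xi_n,\sqrt{-1}\eta_1,\dots,\sqrt{-1}\eta_n,\sqrt{-1}\zeta)^T$ solves (L$_\lambda$) with $\lambda=\sqrt{-1}\mu$, $\sum_i\xi_i^2=\sum_i\eta_i^2+K\zeta^2$, and $\varDelta=\sum_l\xi_l^2$ has no zero on $U$. Put $b=\frac{2\mu}{1+\mu^2}$, $C=\mathrm{diag}(1,\dots,1,1,\dots,1,K)$, $\sigma=\mathrm{diag}(1,\dots,1,-1,\dots,-1,-1)$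 (blocks $n,n,1$) and $$G(\lambda)=\frac1{\lambda^2+\mu^2}\Big(\lambda^2+\frac{2\sqrt{-1}\lambda\mu}{H^*CH}[\sigma,HH^*]\sigma C-\frac{2\mu^2}{H^*CH}(\sigma HH^*+HH^*\sigma)\sigma C+\mu^2\Big).$$ 1. $\widetilde\rho_i=\rho_i-\frac{2\mu\zeta\xi_i}{\varDelta}$, $\widetilde\gamma_{ij}=\gamma_{ij}+\frac{2\mu\xi_i\eta_j}{\varDelta}$ $(i\ne j)$, $\widetilde\gamma_{ii}=0$ solve (GC). 2. If $\omega$ solves ($\Omega$) for $\gamma$, then $\widetilde\omega_{i\alpha}=\omega_{i\alpha}-\sum_j\frac{2\xi_i\xi_j}{\varDelta}\omega_{j\alpha}$ has values in $O(n)$ and solves ($\Omega$) for $\widetilde\gamma$; if $\mu\ne0$, $\widetilde\omega=G(0)_{[1,1]}\omega$, where $G(0)_{[1,1]}$ is the upper left $n\times n$ block of $G(0)$. 3. If $(\vec p,\vec q,\vec r)$ is a frame for $(\rho,\gamma)$, then $(\widetilde{\vec p},\widetilde{\vec q},\widetilde{\vec r})^T=G(1)(\vec p,\vec q,\vec r)^T$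 is given by $$\widetilde{\vec p}_i=\vec p_i-\sum_j\frac{b\mu\xi_i\xi_j}\varDelta\vec p_j-\sum_j\frac{b\xi_i\eta_j}\varDelta\vec q_j-\frac{Kb\zeta\xi_i}\varDelta\vec r,$$ $$\widetilde{\vec q}_i=\vec q_i+\sum_j\frac{b\eta_i\xi_j}\varDelta\vec p_j-\sum_j\frac{b\mu\eta_i\eta_j}\varDelta\vec q_j-\frac{Kb\mu\zeta\eta_i}\varDelta\vec r,$$ $$\widetilde{\vec r}=\vec r+\sum_j\frac{b\zeta\xi_j}\varDelta\vec p_j-\sum_j\frac{b\mu\zeta\eta_j}\varDelta\vec q_j-\frac{Kb\mu\zeta^2}\varDelta\vec r,$$ and it is a frame for $(\widetilde\rho,\widetilde\gamma)$; in particular it solves the new structure equations. 4. If moreover $\omega$ solves ($\Omega$) for $\gamma$, then on the set of points of $U$ where all $\widetilde\rho_i\ne0$, $\widetilde{\vec r}$ is an immersion into $M_{2n}(K)$ whose induced metric has constant curvature $K$, with flat normal bundle and linearly independent curvature normals; its first and second fundamental forms are $\sum_i\widetilde\rho_i^2dx_i^2$ and $\sum_{i,\alpha}\widetilde\rho_i\widetilde\omega_{i\alpha}dx_i^2\,\widetilde{\vec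 n}_\alpha$ for the parallel orthonormal normal fields $\widetilde{\vec n}_\alpha=\sum_i\widetilde\omega_{i\alpha}\widetilde{\vec p}_i$. 5. At every point where all $\rho_i\ne0$, $\widetilde{\vec V}=\widetilde{\vec r}$ is given in terms of $\vec V=\vec r$ by $$\widetilde{\vec V}=\sum_j\frac{b\zeta\xi_j}{\varDelta\rho_j}\frac{\partial^2\vec V}{\partial x_j^2}+\sum_j\frac{b\zeta}{\varDelta\rho_j^2}\Big(-\xi_j\partial_j\rho_j+\sum_{k\ne j}\xi_k\partial_j\rho_k-\mu\rho_j\eta_j\Big)\frac{\partial\vec V}{\partial x_j}+\Big(1-\frac{Kb\mu\zeta^2}\varDelta+\sum_j\frac{Kb\zeta\rho_j\xi_j}\varDelta\Big)\vec V.$$ -/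

import Mathlib

namespace SpaceFormDarboux

noncomputable section

/-- The coordinate space in which the local coordinates `x₁, …, xₙ` vary. -/
abbrev Coord (n : ℕ) : Type := Fin n → ℝ

/-- The ambient linear space `R_{2n+1}(K)`, as a vector space. -/
abbrev Ambient (n : ℕ) : Type := Fin (2 * n + 1) → ℝ

/-- The partial derivative `∂ᵢ f`. -/
def pd {n : ℕ} {F : Type*} [NormedAddCommGroup F] [NormedSpace ℝ F]
    (i : Fin n) (f : Coord n → F) (x : Coord n) : F :=
  fderiv ℝ f x (Pi.single i 1)

/-! ### The space forms -/

/-- The inner product of `R_{2n+1}(K)`: Euclidean for `K = 0, 1`, and Lorentzian, with negative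
last direction, for `K = -1`. -/
def ambientInner {n : ℕ} (K : ℝ) (x y : Ambient n) : ℝ :=
  (∑ a : Fin (2 * n), x a.castSucc * y a.castSucc)
    + (if K = -1 then -1 else 1) * (x (Fin.last (2 * n)) * y (Fin.last (2 * n)))

/-- The standard model of `M_{2n}(K)` in `R_{2n+1}(K)`: a hyperplane for `K = 0`, and the quadric
`x · x = K` for `K = ±1`. -/
def spaceForm (n : ℕ) (K : ℝ) : Set (Ambient n) :=
  {x | (K = 0 → x (Fin.last (2 * n)) = 0) ∧ (K ≠ 0 → ambientInner K x x = K)}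

/-- The tangent space of `M_{2n}(K)` at `y`. -/
def spaceFormTangent {n : ℕ} (K : ℝ) (y : Ambient n) : Set (Ambient n) :=
  {X | (K = 0 → X (Fin.last (2 * n)) = 0) ∧ (K ≠ 0 → ambientInner K y X = 0)}

/-! ### Geometry of an immersion in coordinates -/

/-- The Christoffel symbols `Γᵏᵢⱼ` of a metric `g`. -/
def christoffel {n : ℕ} (g : Coord n → Matrix (Fin n) (Fin n) ℝ) (k i j : Fin n)
    (x : Coord n) : ℝ :=
  (1 / 2) * ∑ l, (g x)⁻¹ k l *
    (pd i (fun y => g y j l) x + pd j (fun y => g y i l) x - pd l (fun y => g y i j) x)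

/-- The curvature components `Rˡₖᵢⱼ`, where `R(∂ᵢ, ∂ⱼ)∂ₖ = ∑ₗ Rˡₖᵢⱼ ∂ₗ`. -/
def riemann {n : ℕ} (g : Coord n → Matrix (Fin n) (Fin n) ℝ) (l k i j : Fin n)
    (x : Coord n) : ℝ :=
  pd i (christoffel g l j k) x - pd j (christoffel g l i k) x
    + ∑ m, (christoffel g l i m x * christoffel g m j k x
          - christoffel g l j m x * christoffel g m i k x)

/-- The metric `g` has constant curvature `K`: `R(X, Y)Z = K (g(Y, Z) X - g(X, Z) Y)`. -/
def HasConstantCurvature {n : ℕ} (K : ℝ) (U : Set (Coord n))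
    (g : Coord n → Matrix (Fin n) (Fin n) ℝ) : Prop :=
  ∀ x ∈ U, ∀ l k i j : Fin n, riemann g l k i j x =
    K * (g x j k * (if l = i then 1 else 0) - g x i k * (if l = j then 1 else 0))

/-- The first fundamental form of `V`. -/
def inducedMetric {n : ℕ} (K : ℝ) (V : Coord n → Ambient n) (x : Coord n) :
    Matrix (Fin n) (Fin n) ℝ :=
  Matrix.of fun i j => ambientInner K (pd i V x) (pd j V x)

/-- The normal space, in the tangent space of `M_{2n}(K)`, of the immersion `V` at `x`. -/
def normalSpace {n : ℕ} (K : ℝ) (V : Coord n → Ambient n) (x : Coord n) : Set (Ambient n) :=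
  {ν | ν ∈ spaceFormTangent K (V x) ∧ ∀ i, ambientInner K ν (pd i V x) = 0}

/-- `e₁, …, eₙ` is a smooth orthonormal frame of the normal bundle, parallel for the normal
connection. -/
structure IsParallelNormalFrame {n : ℕ} (K : ℝ) (U : Set (Coord n)) (V : Coord n → Ambient n)
    (e : Fin n → Coord n → Ambient n) : Prop where
  smooth : ∀ α, ContDiffOn ℝ ((⊤ : ℕ∞) : WithTop ℕ∞) (e α) U
  normal : ∀ x ∈ U, ∀ α, e α x ∈ normalSpace K V x
  orthonormal : ∀ x ∈ U, ∀ α β, ambientInner K (e α x) (e β x) = if α = β then 1 else 0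
  parallel : ∀ x ∈ U, ∀ α i, ∀ ν ∈ normalSpace K V x, ambientInner K (pd i (e α) x) ν = 0

/-- The normal bundle is flat: it has parallel orthonormal frames near every point. -/
def HasFlatNormalBundle {n : ℕ} (K : ℝ) (U : Set (Coord n)) (V : Coord n → Ambient n) : Prop :=
  ∀ x ∈ U, ∃ N : Set (Coord n), IsOpen N ∧ x ∈ N ∧ N ⊆ U ∧
    ∃ e : Fin n → Coord n → Ambient n, IsParallelNormalFrame K N V e

/-- `h` is a curvature normal of `V` at `x`: there is a tangent vector `X ≠ 0` such that
`II(X, Y) = g(X, Y) h` for all tangent vectors `Y` (both sides are normal vectors, tested here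
against all normal vectors `ν`). -/
def IsCurvatureNormal {n : ℕ} (K : ℝ) (V : Coord n → Ambient n) (x : Coord n)
    (h : Ambient n) : Prop :=
  h ∈ normalSpace K V x ∧ ∃ X : Fin n → ℝ, X ≠ 0 ∧
    ∀ Y : Fin n → ℝ, ∀ ν ∈ normalSpace K V x,
      ∑ i, ∑ j, X i * Y j * ambientInner K (pd i (pd j V) x) ν =
        (∑ i, ∑ j, X i * Y j * inducedMetric K V x i j) * ambientInner K h ν

/-- `V` is a smooth isometric immersion of a piece of a space form `M_n(K)` into `M_{2n}(K)` with
flat normal bundle and linearly independent curvature normals. -/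
structure IsSpaceFormImmersion {n : ℕ} (K : ℝ) (U : Set (Coord n))
    (V : Coord n → Ambient n) : Prop where
  smooth : ContDiffOn ℝ ((⊤ : ℕ∞) : WithTop ℕ∞) V U
  mem : ∀ x ∈ U, V x ∈ spaceForm n K
  immersion : ∀ x ∈ U, LinearIndependent ℝ (fun i => pd i V x)
  curvature : HasConstantCurvature K U (inducedMetric K V)
  flat : HasFlatNormalBundle K U V
  curvatureNormals : ∀ x ∈ U,
    LinearIndependent ℝ (fun h : {h : Ambient n // IsCurvatureNormal K V x h} => h.1)

/-- `V` is an immersion into `M_{2n}(K)`, with parallel orthonormal normal frame `e₁, …, eₙ`, and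
`I = ∑ ρᵢ² dxᵢ²`, `II = ∑ ρᵢ ω_{iα} dxᵢ² e_α` with `ω` in `O(n)`. -/
structure HasPrincipalForms {n : ℕ} (K : ℝ) (U : Set (Coord n)) (V : Coord n → Ambient n)
    (ρ : Fin n → Coord n → ℝ) (ω : Coord n → Matrix (Fin n) (Fin n) ℝ)
    (e : Fin n → Coord n → Ambient n) : Prop where
  smooth : ContDiffOn ℝ ((⊤ : ℕ∞) : WithTop ℕ∞) V U
  smooth_rho : ∀ i, ContDiffOn ℝ ((⊤ : ℕ∞) : WithTop ℕ∞) (ρ i) U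
  smooth_omega : ∀ i α, ContDiffOn ℝ ((⊤ : ℕ∞) : WithTop ℕ∞) (fun x => ω x i α) U
  mem : ∀ x ∈ U, V x ∈ spaceForm n K
  rho_ne_zero : ∀ x ∈ U, ∀ i, ρ i x ≠ 0
  orthogonal : ∀ x ∈ U, ω x ∈ Matrix.orthogonalGroup (Fin n) ℝ
  frame : IsParallelNormalFrame K U V e
  first : ∀ x ∈ U, ∀ i j, inducedMetric K V x i j = if i = j then ρ i x ^ 2 else 0
  second : ∀ x ∈ U, ∀ i j α, ambientInner K (pd i (pd j V) x) (e α x) =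
    if i = j then ρ i x * ω x i α else 0

/-! ### The integrable system -/

/-- The Gauss-Codazzi equations for `(ρᵢ)` and `(γᵢⱼ)`, with the convention `γᵢᵢ = 0`. The `ρᵢ` may
have zeros. -/
structure GaussCodazzi {n : ℕ} (K : ℝ) (U : Set (Coord n)) (ρ : Fin n → Coord n → ℝ)
    (γ : Fin n → Fin n → Coord n → ℝ) : Prop where
  smooth_rho : ∀ i, ContDiffOn ℝ ((⊤ : ℕ∞) : WithTop ℕ∞) (ρ i) U
  smooth_gamma : ∀ i j, ContDiffOn ℝ ((⊤ : ℕ∞) : WithTop ℕ∞) (γ i j) U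
  diag : ∀ x ∈ U, ∀ i, γ i i x = 0
  eq₁ : ∀ x ∈ U, ∀ i j, i ≠ j →
    pd i (γ i j) x + pd j (γ j i) x
      = ∑ l ∈ (Finset.univ.erase i).erase j, γ l i x * γ l j x
  eq₂ : ∀ x ∈ U, ∀ i j k, i ≠ j → i ≠ k → j ≠ k →
    pd k (γ i j) x + γ i k x * γ k j x = 0
  eq₃ : ∀ x ∈ U, ∀ i j, i ≠ j →
    pd i (γ j i) x + pd j (γ i j) x
      - (∑ l ∈ (Finset.univ.erase i).erase j, γ i l x * γ j l x) - K * ρ i x * ρ j x = 0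
  eq₄ : ∀ x ∈ U, ∀ i j, i ≠ j → pd j (ρ i) x + γ i j x * ρ j x = 0

/-- The Codazzi equations for the `O(n)`-valued map `ω`. -/
structure OmegaSystem {n : ℕ} (U : Set (Coord n)) (γ : Fin n → Fin n → Coord n → ℝ)
    (ω : Coord n → Matrix (Fin n) (Fin n) ℝ) : Prop where
  smooth : ∀ i α, ContDiffOn ℝ ((⊤ : ℕ∞) : WithTop ℕ∞) (fun x => ω x i α) U
  orthogonal : ∀ x ∈ U, ω x ∈ Matrix.orthogonalGroup (Fin n) ℝ
  offdiag : ∀ x ∈ U, ∀ i j α, i ≠ j → pd j (fun y => ω y i α) x + γ i j x * ω x j α = 0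
  diag : ∀ x ∈ U, ∀ i α,
    pd i (fun y => ω y i α) x = ∑ k ∈ Finset.univ.erase i, γ k i x * ω x k α

/-- The linear system with spectral parameter `lam` (in `𝕜`) for smooth functions
`u₁, …, uₙ, v₁, …, vₙ, w` with values in a vector space `F`. -/
structure LaxSystem {n : ℕ} {𝕜 F : Type*} [Field 𝕜] [NormedAddCommGroup F] [NormedSpace ℝ F]
    [Module 𝕜 F] (K : ℝ) (U : Set (Coord n)) (ρ : Fin n → Coord n → ℝ)
    (γ : Fin n → Fin n → Coord n → ℝ) (lam : 𝕜) (u v : Fin n → Coord n → F) (w : Coord n → F) :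
    Prop where
  smooth_u : ∀ i, ContDiffOn ℝ ((⊤ : ℕ∞) : WithTop ℕ∞) (u i) U
  smooth_v : ∀ i, ContDiffOn ℝ ((⊤ : ℕ∞) : WithTop ℕ∞) (v i) U
  smooth_w : ContDiffOn ℝ ((⊤ : ℕ∞) : WithTop ℕ∞) w U
  u_diag : ∀ x ∈ U, ∀ i,
    pd i (u i) x = (∑ k ∈ Finset.univ.erase i, γ k i x • u k x) - lam • v i x
  u_offdiag : ∀ x ∈ U, ∀ i j, i ≠ j → pd j (u i) x = -(γ i j x • u j x)
  v_diag : ∀ x ∈ U, ∀ i,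
    pd i (v i) x = (∑ k ∈ Finset.univ.erase i, γ i k x • v k x) + lam • u i x
      - (K * ρ i x) • w x
  v_offdiag : ∀ x ∈ U, ∀ i j, i ≠ j → pd j (v i) x = -(γ j i x • v j x)
  w_eq : ∀ x ∈ U, ∀ i, pd i w x = ρ i x • v i x

/-- A frame `(p, q, r)` of an immersion: the point `r` lies on `M_{2n}(K)`, the vectors
`p₁, …, pₙ, q₁, …, qₙ` are an orthonormal basis of the tangent space of `M_{2n}(K)` at `r`, and the
structure equations, i.e. the linear system at spectral parameter `1`, hold. -/
structure IsMovingFrame {n : ℕ} (K : ℝ) (U : Set (Coord n)) (ρ : Fin n → Coord n → ℝ)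
    (γ : Fin n → Fin n → Coord n → ℝ) (p q : Fin n → Coord n → Ambient n)
    (r : Coord n → Ambient n) : Prop where
  structure_eq : LaxSystem K U ρ γ (1 : ℝ) p q r
  mem : ∀ x ∈ U, r x ∈ spaceForm n K
  p_tangent : ∀ x ∈ U, ∀ i, p i x ∈ spaceFormTangent K (r x)
  q_tangent : ∀ x ∈ U, ∀ i, q i x ∈ spaceFormTangent K (r x)
  inner_pp : ∀ x ∈ U, ∀ i j, ambientInner K (p i x) (p j x) = if i = j then 1 else 0
  inner_qq : ∀ x ∈ U, ∀ i j, ambientInner K (q i x) (q j x) = if i = j then 1 else 0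
  inner_pq : ∀ x ∈ U, ∀ i j, ambientInner K (p i x) (q j x) = 0

/-! ### The quantities attached to an immersion in principal coordinates -/

/-- `γᵢⱼ = -∂ⱼρᵢ / ρⱼ` for `i ≠ j`, and `γᵢᵢ = 0`. -/
def gammaOf {n : ℕ} (ρ : Fin n → Coord n → ℝ) (i j : Fin n) (x : Coord n) : ℝ :=
  if i = j then 0 else -(pd j (ρ i) x / ρ j x)

/-- `pᵢ = ∑_α ω_{iα} e_α`. -/
def pOf {n : ℕ} (ω : Coord n → Matrix (Fin n) (Fin n) ℝ) (e : Fin n → Coord n → Ambient n)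
    (i : Fin n) (x : Coord n) : Ambient n :=
  ∑ α, ω x i α • e α x

/-- `qᵢ = ρᵢ⁻¹ ∂ᵢV`. -/
def qOf {n : ℕ} (ρ : Fin n → Coord n → ℝ) (V : Coord n → Ambient n)
    (i : Fin n) (x : Coord n) : Ambient n :=
  (ρ i x)⁻¹ • pd i V x

/-- `e_α = ∑ᵢ ω_{iα} pᵢ`, the inverse of the relation `pᵢ = ∑_α ω_{iα} e_α` for `ω` in `O(n)`. -/
def normalOf {n : ℕ} (ω : Coord n → Matrix (Fin n) (Fin n) ℝ) (p : Fin n → Coord n → Ambient n)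
    (α : Fin n) (x : Coord n) : Ambient n :=
  ∑ i, ω x i α • p i x

/-! ### The Darboux matrix -/

/-- The index set of the `2n + 1` components, in blocks of sizes `n`, `n`, `1`. -/
abbrev Idx (n : ℕ) : Type := Fin n ⊕ Fin n ⊕ Unit

/-- The column `(u₁, …, uₙ, v₁, …, vₙ, w)`. -/
def column {n : ℕ} {F : Type*} (u v : Fin n → F) (w : F) : Idx n → F :=
  Sum.elim u (Sum.elim v fun _ => w)

/-- `C = diag(1, …, 1, 1, …, 1, K)`. -/
def matC (n : ℕ) (K : ℝ) : Matrix (Idx n) (Idx n) ℂ :=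
  Matrix.diagonal (column (fun _ => 1) (fun _ => 1) (K : ℂ))

/-- `σ = diag(1, …, 1, -1, …, -1, -1)`. -/
def matSigma (n : ℕ) : Matrix (Idx n) (Idx n) ℂ :=
  Matrix.diagonal (column (fun _ => 1) (fun _ => -1) (-1))

/-- The Darboux matrix
`G(λ) = (λ² + (2iλμ / H^*CH) [σ, HH^*]σC - (2μ² / H^*CH) (σHH^* + HH^*σ)σC + μ²) / (λ² + μ²)`. -/
def darbouxMatrix {ι : Type*} [Fintype ι] [DecidableEq ι] (σ C : Matrix ι ι ℂ) (μ : ℝ)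
    (H : ι → ℂ) (lam : ℂ) : Matrix ι ι ℂ :=
  (1 / (lam ^ 2 + (μ : ℂ) ^ 2)) •
    (lam ^ 2 • (1 : Matrix ι ι ℂ)
      + (2 * Complex.I * lam * μ / (star H ⬝ᵥ C.mulVec H)) •
          ((σ * Matrix.vecMulVec H (star H) - Matrix.vecMulVec H (star H) * σ) * σ * C)
      - (2 * (μ : ℂ) ^ 2 / (star H ⬝ᵥ C.mulVec H)) •
          ((σ * Matrix.vecMulVec H (star H) + Matrix.vecMulVec H (star H) * σ) * σ * C)
      + (μ : ℂ) ^ 2 • (1 : Matrix ι ι ℂ))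

/-- `H = (ξ₁, …, ξₙ, iη₁, …, iηₙ, iζ)` at the point `x`. -/
def vecH {n : ℕ} (ξ η : Fin n → Coord n → ℝ) (ζ : Coord n → ℝ) (x : Coord n) : Idx n → ℂ :=
  column (fun i => (ξ i x : ℂ)) (fun i => Complex.I * (η i x : ℂ)) (Complex.I * (ζ x : ℂ))

/-- The Darboux matrix `G(λ)` of the geometric system at the point `x`. -/
def geoDarboux {n : ℕ} (K μ : ℝ) (ξ η : Fin n → Coord n → ℝ) (ζ : Coord n → ℝ) (lam : ℂ)
    (x : Coord n) : Matrix (Idx n) (Idx n) ℂ :=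
  darbouxMatrix (matSigma n) (matC n K) μ (vecH ξ η ζ x) lam

/-- `Δ = ∑ ξ_l²`. -/
def Del {n : ℕ} (ξ : Fin n → Coord n → ℝ) (x : Coord n) : ℝ := ∑ l, ξ l x ^ 2

/-- `(ξ, iη, iζ)`, with `ξ, η, ζ` real, solves the linear system at spectral parameter `iμ`,
`∑ ξᵢ² = ∑ ηᵢ² + Kζ²`, and the denominator `Δ` of the transformation has no zero. -/
structure IsDarbouxData {n : ℕ} (K : ℝ) (U : Set (Coord n)) (ρ : Fin n → Coord n → ℝ)
    (γ : Fin n → Fin n → Coord n → ℝ) (μ : ℝ) (ξ η : Fin n → Coord n → ℝ) (ζ : Coord n → ℝ) :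
    Prop where
  lax : LaxSystem K U ρ γ (Complex.I * (μ : ℂ)) (fun i x => (ξ i x : ℂ))
    (fun i x => Complex.I * (η i x : ℂ)) (fun x => Complex.I * (ζ x : ℂ))
  quadric : ∀ x ∈ U, ∑ i, ξ i x ^ 2 = (∑ i, η i x ^ 2) + K * ζ x ^ 2
  del_ne_zero : ∀ x ∈ U, Del ξ x ≠ 0

/-! ### The explicit transformation formulas -/

/-- `b = 2μ / (1 + μ²)`. -/
def bCoeff (μ : ℝ) : ℝ := 2 * μ / (1 + μ ^ 2)

def rhoT {n : ℕ} (μ : ℝ) (ξ : Fin n → Coord n → ℝ) (ζ : Coord n → ℝ)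
    (ρ : Fin n → Coord n → ℝ) (i : Fin n) (x : Coord n) : ℝ :=
  ρ i x - 2 * μ * ζ x * ξ i x / Del ξ x

/-- The formula for `γᵢⱼ` is meant for `i ≠ j`; by convention, `γᵢᵢ = 0`. -/
def gammaT {n : ℕ} (μ : ℝ) (ξ η : Fin n → Coord n → ℝ)
    (γ : Fin n → Fin n → Coord n → ℝ) (i j : Fin n) (x : Coord n) : ℝ :=
  if i = j then 0 else γ i j x + 2 * μ * ξ i x * η j x / Del ξ x

def omegaT {n : ℕ} (ξ : Fin n → Coord n → ℝ) (ω : Coord n → Matrix (Fin n) (Fin n) ℝ)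
    (x : Coord n) : Matrix (Fin n) (Fin n) ℝ :=
  Matrix.of fun i α => ω x i α - ∑ j, 2 * ξ i x * ξ j x / Del ξ x * ω x j α

def pT {n : ℕ} (K μ : ℝ) (ξ η : Fin n → Coord n → ℝ) (ζ : Coord n → ℝ)
    (p q : Fin n → Coord n → Ambient n) (r : Coord n → Ambient n) (i : Fin n) (x : Coord n) :
    Ambient n :=
  p i x - (∑ j, (bCoeff μ * μ * ξ i x * ξ j x / Del ξ x) • p j x)
    - (∑ j, (bCoeff μ * ξ i x * η j x / Del ξ x) • q j x)
    - (K * bCoeff μ * ζ x * ξ i x / Del ξ x) • r x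

def qT {n : ℕ} (K μ : ℝ) (ξ η : Fin n → Coord n → ℝ) (ζ : Coord n → ℝ)
    (p q : Fin n → Coord n → Ambient n) (r : Coord n → Ambient n) (i : Fin n) (x : Coord n) :
    Ambient n :=
  q i x + (∑ j, (bCoeff μ * η i x * ξ j x / Del ξ x) • p j x)
    - (∑ j, (bCoeff μ * μ * η i x * η j x / Del ξ x) • q j x)
    - (K * bCoeff μ * μ * ζ x * η i x / Del ξ x) • r x

def rT {n : ℕ} (K μ : ℝ) (ξ η : Fin n → Coord n → ℝ) (ζ : Coord n → ℝ)
    (p q : Fin n → Coord n → Ambient n) (r : Coord n → Ambient n) (x : Coord n) :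
    Ambient n :=
  r x + (∑ j, (bCoeff μ * ζ x * ξ j x / Del ξ x) • p j x)
    - (∑ j, (bCoeff μ * μ * ζ x * η j x / Del ξ x) • q j x)
    - (K * bCoeff μ * μ * ζ x ^ 2 / Del ξ x) • r x

/-- The transformed position vector in terms of the old position vector `V` and its derivatives. -/
def positionT {n : ℕ} (K μ : ℝ) (ξ η : Fin n → Coord n → ℝ) (ζ : Coord n → ℝ)
    (ρ : Fin n → Coord n → ℝ) (V : Coord n → Ambient n) (x : Coord n) : Ambient n :=
  (∑ j, (bCoeff μ * ζ x * ξ j x / (Del ξ x * ρ j x)) • pd j (pd j V) x)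
    + (∑ j, (bCoeff μ * ζ x / (Del ξ x * ρ j x ^ 2) *
        (-(ξ j x * pd j (ρ j) x) + (∑ k ∈ Finset.univ.erase j, ξ k x * pd j (ρ k) x)
          - μ * ρ j x * η j x)) • pd j V x)
    + (1 - K * bCoeff μ * μ * ζ x ^ 2 / Del ξ x
        + ∑ j, K * bCoeff μ * ζ x * ρ j x * ξ j x / Del ξ x) • V x

end

end SpaceFormDarboux

open SpaceFormDarboux

/-! All the linear equations have one shape, `HasRotPd`: ∂_j a_i = -γ_ij a_j for i ≠ j, and ∂_j a_j
= Σ γ_kj a_k plus an inhomogeneous term. The families ω, p and ξ satisfy it for γ; q and η satisfy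
it for the transpose of γ. Two facts about this shape carry the transformation. The connection is
skew, so the derivative of Σ a_i b_i contains only the inhomogeneous terms (`HasRotPd.sum_smul`).
And subtracting f ξ_i S from a_i gives the same shape with γ_ij + ξ_i t in place of γ_ij, provided
that ∂_j f = -f ξ_j t and f ∂_j S = t a_j (`HasRotPd.transform`).

For the frame, put P = Σ ξ_j p_j and Q = Σ η_j q_j + Kζ r. By skewness ∂_j P = μη_j p_j - ξ_j q_j
and ∂_j Q = η_j p_j + μξ_j q_j. Hence ∂_j(μP + Q) = (1 + μ²)η_j p_j and ∂_j(P - μQ) = -(1 + μ²)ξ_j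
q_j: each derivative is a multiple of a single frame vector. The new frame is p_i - (b/Δ)ξ_i(μP +
Q), q_i + (b/Δ)η_i(P - μQ), r + (b/Δ)ζ(P - μQ), and b(1 + μ²) = 2μ is exactly the compatibility
between f and t, so the new structure equations follow. The quadric condition says that P and Q have
the same square Δ; they are orthogonal, and the new frame arises from p, q (and from r, if K ≠ 0) by
a rotation in their plane (`IsAdaptedFrame.darboux`). For ω the same scheme gives the reflection in
the hyperplane orthogonal to ξ.

The new Gauss-Codazzi equations are verified directly, since no frame is given there. The geometry
of the new immersion is read off from a frame: p spans the normal space, ∂_i r = ρ_i q_i, and (GC)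
makes the curvature of the diagonal metric constant. Conversely, in part (a) the structure equations
come from testing derivatives against an orthonormal frame, and (GC) is their compatibility
condition. The formula for the position vector results from solving the structure equations for p_j.
-/

namespace SpaceFormDarboux

/-! ### Partial derivatives of smooth maps -/

section Calculus

variable {n : ℕ} {F : Type*} [NormedAddCommGroup F] [NormedSpace ℝ F]

/-- Smoothness on a set. -/
abbrev SmoothOn (U : Set (Coord n)) (f : Coord n → F) : Prop :=
  ContDiffOn ℝ ((⊤ : ℕ∞) : WithTop ℕ∞) f U

/-- `f` is differentiable at `x` and `∂ᵢ f` takes the value `f'` there. -/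
def HasPd (i : Fin n) (f : Coord n → F) (f' : F) (x : Coord n) : Prop :=
  DifferentiableAt ℝ f x ∧ pd i f x = f'

namespace HasPd

variable {i : Fin n} {f g : Coord n → F} {f' g' : F} {x : Coord n}

theorem eq (h : HasPd i f f' x) : pd i f x = f' := h.2

theorem const (i : Fin n) (a : F) (x : Coord n) : HasPd i (fun _ => a) 0 x :=
  ⟨by fun_prop, by simp [pd]⟩

theorem cast (h : HasPd i f f' x) (e : f' = g') : HasPd i f g' x := e ▸ h

theorem unique (h : HasPd i f f' x) (h' : HasPd i f g' x) : f' = g' := h.2.symm.trans h'.2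

theorem congr (h : HasPd i f f' x) (e : g =ᶠ[nhds x] f) : HasPd i g f' x :=
  ⟨h.1.congr_of_eventuallyEq e, by rw [pd, e.fderiv_eq]; exact h.2⟩

theorem congr_on {U : Set (Coord n)} (h : HasPd i f f' x) (hU : IsOpen U) (hx : x ∈ U)
    (e : ∀ y ∈ U, g y = f y) : HasPd i g f' x :=
  h.congr (Filter.eventuallyEq_of_mem (hU.mem_nhds hx) e)

theorem of_forall (h : HasPd i f f' x) (e : ∀ y, g y = f y) : HasPd i g f' x :=
  (funext e : g = f) ▸ h

theorem add (hf : HasPd i f f' x) (hg : HasPd i g g' x) :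
    HasPd i (fun y => f y + g y) (f' + g') x :=
  ⟨hf.1.fun_add hg.1, by rw [← hf.2, ← hg.2, pd, fderiv_fun_add hf.1 hg.1]; rfl⟩

theorem sub (hf : HasPd i f f' x) (hg : HasPd i g g' x) :
    HasPd i (fun y => f y - g y) (f' - g') x :=
  ⟨hf.1.fun_sub hg.1, by rw [← hf.2, ← hg.2, pd, fderiv_fun_sub hf.1 hg.1]; rfl⟩

theorem neg (hf : HasPd i f f' x) : HasPd i (fun y => -f y) (-f') x :=
  ⟨hf.1.fun_neg, by rw [← hf.2, pd, fderiv_fun_neg]; rfl⟩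

theorem sum {ι : Type*} {s : Finset ι} {f : ι → Coord n → F} {f' : ι → F}
    (h : ∀ a ∈ s, HasPd i (f a) (f' a) x) :
    HasPd i (fun y => ∑ a ∈ s, f a y) (∑ a ∈ s, f' a) x :=
  ⟨DifferentiableAt.fun_sum fun a ha => (h a ha).1, by
    rw [pd, fderiv_fun_sum fun a ha => (h a ha).1, sum_apply]
    exact Finset.sum_congr rfl fun a ha => (h a ha).2⟩

theorem smul {c : Coord n → ℝ} {c' : ℝ} (hc : HasPd i c c' x) (hf : HasPd i f f' x) :
    HasPd i (fun y => c y • f y) (c' • f x + c x • f') x :=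
  ⟨hc.1.fun_smul hf.1, by
    rw [← hf.2, ← hc.2, pd, fderiv_fun_smul hc.1 hf.1]
    simp [pd, add_comm]⟩

theorem mul {f g : Coord n → ℝ} {f' g' : ℝ} (hf : HasPd i f f' x) (hg : HasPd i g g' x) :
    HasPd i (fun y => f y * g y) (f' * g x + f x * g') x := hf.smul hg

theorem inv {f : Coord n → ℝ} {f' : ℝ} (hf : HasPd i f f' x) (h0 : f x ≠ 0) :
    HasPd i (fun y => (f y)⁻¹) (-f' / f x ^ 2) x :=
  ⟨hf.1.fun_inv h0, by
    have h : HasFDerivAt (fun y => (f y)⁻¹) _ x :=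
      (hasDerivAt_inv h0).comp_hasFDerivAt x hf.1.hasFDerivAt
    rw [← hf.2, pd, h.fderiv]
    simp only [pd, smul_apply, smul_eq_mul]
    ring⟩

theorem clm {G : Type*} [NormedAddCommGroup G] [NormedSpace ℝ G] (L : F →L[ℝ] G)
    (hf : HasPd i f f' x) : HasPd i (fun y => L (f y)) (L f') x :=
  ⟨L.differentiableAt.comp x hf.1, by
    have h : HasFDerivAt (fun y => L (f y)) _ x := L.hasFDerivAt.comp x hf.1.hasFDerivAt
    rw [← hf.2, pd, h.fderiv]; rfl⟩

theorem coord {ι : Type*} [Fintype ι] {f : Coord n → ι → ℝ} {f' : ι → ℝ} (hf : HasPd i f f' x)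
    (a : ι) : HasPd i (fun y => f y a) (f' a) x :=
  hf.clm (ContinuousLinearMap.proj (R := ℝ) (φ := fun _ : ι => ℝ) a)

end HasPd

theorem SmoothOn.hasPd {U : Set (Coord n)} {f : Coord n → F} (hf : SmoothOn U f) (hU : IsOpen U)
    {x : Coord n} (hx : x ∈ U) (i : Fin n) : HasPd i f (pd i f x) x :=
  ⟨(hf.contDiffAt (hU.mem_nhds hx)).differentiableAt (by simp), rfl⟩

theorem SmoothOn.hasPd_of_eq {U : Set (Coord n)} {f : Coord n → F} (hf : SmoothOn U f)
    (hU : IsOpen U) {x : Coord n} (hx : x ∈ U) {i : Fin n} {f' : F} (h : pd i f x = f') :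
    HasPd i f f' x :=
  h ▸ hf.hasPd hU hx i

theorem SmoothOn.pd {U : Set (Coord n)} {f : Coord n → F} (hf : SmoothOn U f) (hU : IsOpen U)
    (i : Fin n) : SmoothOn U (pd i f) := by
  have h : SmoothOn U (fderiv ℝ f) := hf.fderiv_of_isOpen hU (by simp)
  exact h.clm_apply contDiffOn_const

theorem SmoothOn.pd_comm {U : Set (Coord n)} {f : Coord n → F} (hf : SmoothOn U f)
    (hU : IsOpen U) {x : Coord n} (hx : x ∈ U) (i j : Fin n) :
    SpaceFormDarboux.pd i (SpaceFormDarboux.pd j f) x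
      = SpaceFormDarboux.pd j (SpaceFormDarboux.pd i f) x := by
  have hd : DifferentiableAt ℝ (fderiv ℝ f) x :=
    ((hf.fderiv_of_isOpen (m := ((⊤ : ℕ∞) : WithTop ℕ∞)) hU (by simp)).contDiffAt
      (hU.mem_nhds hx)).differentiableAt (by simp)
  have hs : IsSymmSndFDerivAt ℝ f x :=
    (hf.contDiffAt (hU.mem_nhds hx)).isSymmSndFDerivAt (by
      simp only [minSmoothness_of_isRCLikeNormedField]
      exact WithTop.coe_le_coe.2 (OrderTop.le_top (2 : ℕ∞)))
  have key : ∀ a b : Fin n, SpaceFormDarboux.pd a (SpaceFormDarboux.pd b f) x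
      = fderiv ℝ (fderiv ℝ f) x (Pi.single a 1) (Pi.single b 1) := by
    intro a b
    have : HasFDerivAt (fun y => fderiv ℝ f y (Pi.single b 1))
        ((fderiv ℝ (fderiv ℝ f) x).flip (Pi.single b 1)) x := by
      have := hd.hasFDerivAt.clm_apply (hasFDerivAt_const (Pi.single b (1 : ℝ) : Coord n) x)
      simpa using this
    unfold SpaceFormDarboux.pd
    rw [this.fderiv]; rfl
  rw [key, key]
  exact hs _ _

end Calculus

/-! ### The ambient bilinear form -/

/-- The bilinear form of `R_{2n+1}(K)`. -/
noncomputable def ambientForm {n : ℕ} (K : ℝ) : Ambient n →ₗ[ℝ] Ambient n →ₗ[ℝ] ℝ :=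
  LinearMap.mk₂ ℝ (ambientInner K)
    (by intro a b c; simp only [ambientInner, Pi.add_apply, add_mul, Finset.sum_add_distrib]; ring)
    (by
      intro t a b
      simp only [ambientInner, Pi.smul_apply, smul_eq_mul, mul_assoc, ← Finset.mul_sum]; ring)
    (by intro a b c; simp only [ambientInner, Pi.add_apply, mul_add, Finset.sum_add_distrib]; ring)
    (by
      intro t a b
      simp only [ambientInner, Pi.smul_apply, smul_eq_mul, mul_left_comm _ t, ← Finset.mul_sum]
      ring)

theorem ambientForm_apply {n : ℕ} (K : ℝ) (a b : Ambient n) :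
    ambientForm K a b = ambientInner K a b := rfl

theorem ambientForm_comm {n : ℕ} (K : ℝ) (a b : Ambient n) :
    ambientForm K a b = ambientForm K b a := by
  simp only [ambientForm_apply, ambientInner, mul_comm]

theorem HasPd.inner {n : ℕ} {K : ℝ} {i : Fin n} {f g : Coord n → Ambient n} {f' g' : Ambient n}
    {x : Coord n} (hf : HasPd i f f' x) (hg : HasPd i g g' x) :
    HasPd i (fun y => ambientForm K (f y) (g y)) (ambientForm K f' (g x) + ambientForm K (f x) g')
      x := by
  have h := (HasPd.sum (s := Finset.univ) fun (a : Fin (2 * n)) _ =>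
    (hf.coord a.castSucc).mul (hg.coord a.castSucc)).add
    ((HasPd.const i (if K = -1 then -1 else 1) x).mul
      ((hf.coord (Fin.last (2 * n))).mul (hg.coord (Fin.last (2 * n)))))
  refine HasPd.cast h ?_
  simp only [ambientForm_apply, ambientInner, Finset.sum_add_distrib]
  ring

/-! ### The skew connection of the rotation coefficients -/

section Rotation

variable {n : ℕ} {F : Type*} [NormedAddCommGroup F] [NormedSpace ℝ F]

/-- The `j`-th partial derivatives of the family `a` are given by the skew connection of the
rotation coefficients `γ`, up to an inhomogeneous term `α` in the derivative of `aⱼ`. -/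
def HasRotPd (γ : Fin n → Fin n → Coord n → ℝ) (j : Fin n) (a : Fin n → Coord n → F) (α : F)
    (x : Coord n) : Prop :=
  ∀ i, HasPd j (a i)
    (-(γ i j x • a j x) + if i = j then (∑ k, γ k j x • a k x) + α else 0) x

namespace HasRotPd

variable {γ : Fin n → Fin n → Coord n → ℝ} {j : Fin n} {x : Coord n}

theorem of_cases {a : Fin n → Coord n → F} {α : F} (hγ : γ j j x = 0)
    (hd : HasPd j (a j) ((∑ k ∈ Finset.univ.erase j, γ k j x • a k x) + α) x)
    (ho : ∀ i, i ≠ j → HasPd j (a i) (-(γ i j x • a j x)) x) : HasRotPd γ j a α x := by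
  intro i
  by_cases h : i = j
  · subst h
    refine hd.cast ?_
    rw [Finset.sum_erase _ (by simp [hγ])]
    simp [hγ]
  · exact (ho i h).cast (by simp [h])

theorem diag {a : Fin n → Coord n → F} {α : F} (h : HasRotPd γ j a α x) (hγ : γ j j x = 0) :
    HasPd j (a j) ((∑ k ∈ Finset.univ.erase j, γ k j x • a k x) + α) x := by
  refine (h j).cast ?_
  rw [Finset.sum_erase _ (by simp [hγ])]
  simp [hγ]

theorem offdiag {a : Fin n → Coord n → F} {α : F} (h : HasRotPd γ j a α x) {i : Fin n}
    (hi : i ≠ j) : HasPd j (a i) (-(γ i j x • a j x)) x :=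
  (h i).cast (by simp [hi])

theorem cast {a : Fin n → Coord n → F} {α β : F} (h : HasRotPd γ j a α x) (e : α = β) :
    HasRotPd γ j a β x := e ▸ h

theorem of_forall {a b : Fin n → Coord n → F} {α : F} (h : HasRotPd γ j a α x)
    (e : ∀ i y, b i y = a i y) : HasRotPd γ j b α x :=
  (funext fun i => funext (e i) : b = a) ▸ h

/-- The connection matrix is skew, so its contributions to the derivative of the pairing cancel and
only the inhomogeneous terms survive. -/
theorem sum_smul {a : Fin n → Coord n → ℝ} {α : ℝ} {b : Fin n → Coord n → F} {β : F}
    (ha : HasRotPd γ j a α x) (hb : HasRotPd γ j b β x) :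
    HasPd j (fun y => ∑ i, a i y • b i y) (α • b j x + a j x • β) x := by
  refine (HasPd.sum fun i _ => (ha i).smul (hb i)).cast ?_
  simp only [add_smul, ite_smul, zero_smul, smul_add, smul_ite, smul_zero, Finset.sum_add_distrib,
    Finset.sum_ite_eq', Finset.mem_univ, if_true, smul_neg, neg_smul, Finset.sum_neg_distrib,
    smul_eq_mul, mul_smul, Finset.sum_smul, Finset.smul_sum]
  simp only [smul_comm (a _ x) (γ _ j x)]
  abel

/-- The effect of `a ↦ a - f ξ S` and `γᵢⱼ ↦ γᵢⱼ + ξᵢ tⱼ`. -/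
theorem transform {γ' : Fin n → Fin n → Coord n → ℝ} {ξ : Fin n → Coord n → ℝ} {β t : ℝ}
    {a : Fin n → Coord n → F} {α s : F} {f : Coord n → ℝ} {S : Coord n → F}
    (ha : HasRotPd γ j a α x) (hξ : HasRotPd γ j ξ β x)
    (hf : HasPd j f (-(f x * (ξ j x * t))) x) (hS : HasPd j S s x) (hs : f x • s = t • a j x)
    (hγ : γ j j x = 0) (hγ' : ∀ i, γ' i j x = if i = j then 0 else γ i j x + ξ i x * t) :
    HasRotPd γ' j (fun i y => a i y - (f y * ξ i y) • S y)
      (α - (f x * β) • S x - t • (∑ k, ξ k x • a k x)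
        + (f x * t * ∑ k, ξ k x ^ 2) • S x) x := by
  -- The rule γ_kj + ξ_k t would give ξ_j t at k = j, but the new diagonal coefficient is zero; the
  -- last term corrects this.
  have hsum : ∑ k, γ' k j x • (a k x - (f x * ξ k x) • S x)
      = (∑ k, (γ k j x + ξ k x * t) • (a k x - (f x * ξ k x) • S x))
        - (ξ j x * t) • (a j x - (f x * ξ j x) • S x) := by
    rw [← Finset.sum_erase_add _ _ (Finset.mem_univ j),
      ← Finset.sum_erase_add (a := j) _ (fun k => (γ k j x + ξ k x * t) • _) (Finset.mem_univ j),
      hγ' j, if_pos rfl, hγ, zero_add, zero_smul, add_zero, add_sub_cancel_right]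
    refine Finset.sum_congr rfl fun k hk => ?_
    rw [hγ' k, if_neg (Finset.ne_of_mem_erase hk)]
  have hsum2 : ∑ k, (γ k j x + ξ k x * t) • (a k x - (f x * ξ k x) • S x)
      = (∑ k, γ k j x • a k x) - (f x * ∑ k, γ k j x * ξ k x) • S x + t • (∑ k, ξ k x • a k x)
        - (f x * t * ∑ k, ξ k x ^ 2) • S x := by
    simp only [Finset.mul_sum, Finset.smul_sum, Finset.sum_smul, ← Finset.sum_sub_distrib,
      ← Finset.sum_add_distrib]
    exact Finset.sum_congr rfl fun k _ => by module
  intro i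
  refine ((ha i).sub ((hf.mul (hξ i)).smul hS)).cast ?_
  -- The derivative of S contributes exactly the term ξ_i t a_j by which the rotation coefficient
  -- changes.
  have hs' : (f x * ξ i x) • s = (ξ i x * t) • a j x := by
    rw [mul_comm, mul_smul, hs, smul_smul]
  rw [hsum, hsum2, hγ' i, hs']
  simp only [smul_eq_mul]
  by_cases h : i = j
  · subst h
    simp only [if_true, hγ]
    module
  · simp only [if_neg h]
    module

end HasRotPd

end Rotation

/-! ### The linear systems in terms of the skew connection -/

section Lax

variable {n : ℕ} {K : ℝ} {U : Set (Coord n)} {ρ : Fin n → Coord n → ℝ}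
  {γ : Fin n → Fin n → Coord n → ℝ} {x : Coord n}

theorem LaxSystem.hasRotPd_u {𝕜 F : Type*} [Field 𝕜] [NormedAddCommGroup F] [NormedSpace ℝ F]
    [Module 𝕜 F] {lam : 𝕜} {u v : Fin n → Coord n → F} {w : Coord n → F}
    (h : LaxSystem K U ρ γ lam u v w) (hγ : ∀ x ∈ U, ∀ i, γ i i x = 0) (hU : IsOpen U)
    (hx : x ∈ U) (j : Fin n) : HasRotPd γ j u (-(lam • v j x)) x :=
  .of_cases (hγ x hx j)
    (by rw [← sub_eq_add_neg]; exact SmoothOn.hasPd_of_eq (h.smooth_u j) hU hx (h.u_diag x hx j))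
    fun i hi => SmoothOn.hasPd_of_eq (h.smooth_u i) hU hx (h.u_offdiag x hx i j hi)

/-- Transposing the coefficients puts v on the same footing as u, so that one transformation rule
serves both. -/
theorem LaxSystem.hasRotPd_v {𝕜 F : Type*} [Field 𝕜] [NormedAddCommGroup F] [NormedSpace ℝ F]
    [Module 𝕜 F] {lam : 𝕜} {u v : Fin n → Coord n → F} {w : Coord n → F}
    (h : LaxSystem K U ρ γ lam u v w) (hγ : ∀ x ∈ U, ∀ i, γ i i x = 0) (hU : IsOpen U)
    (hx : x ∈ U) (j : Fin n) :
    HasRotPd (fun i k => γ k i) j v (lam • u j x - (K * ρ j x) • w x) x :=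
  .of_cases (hγ x hx j)
    (by rw [← add_sub_assoc]; exact SmoothOn.hasPd_of_eq (h.smooth_v j) hU hx (h.v_diag x hx j))
    fun i hi => SmoothOn.hasPd_of_eq (h.smooth_v i) hU hx (h.v_offdiag x hx i j hi)

theorem LaxSystem.hasPd_w {𝕜 F : Type*} [Field 𝕜] [NormedAddCommGroup F] [NormedSpace ℝ F]
    [Module 𝕜 F] {lam : 𝕜} {u v : Fin n → Coord n → F} {w : Coord n → F}
    (h : LaxSystem K U ρ γ lam u v w) (hU : IsOpen U)
    (hx : x ∈ U) (j : Fin n) : HasPd j w (ρ j x • v j x) x :=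
  SmoothOn.hasPd_of_eq h.smooth_w hU hx (h.w_eq x hx j)

theorem LaxSystem.of_hasRotPd {𝕜 F : Type*} [Field 𝕜] [NormedAddCommGroup F] [NormedSpace ℝ F]
    [Module 𝕜 F] {lam : 𝕜} {u v : Fin n → Coord n → F} {w : Coord n → F}
    (hγ : ∀ x ∈ U, ∀ i, γ i i x = 0)
    (su : ∀ i, SmoothOn U (u i)) (sv : ∀ i, SmoothOn U (v i)) (sw : SmoothOn U w)
    (hu : ∀ x ∈ U, ∀ j, HasRotPd γ j u (-(lam • v j x)) x)
    (hv : ∀ x ∈ U, ∀ j, HasRotPd (fun i k => γ k i) j v (lam • u j x - (K * ρ j x) • w x) x)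
    (hw : ∀ x ∈ U, ∀ j, HasPd j w (ρ j x • v j x) x) : LaxSystem K U ρ γ lam u v w where
  smooth_u := su
  smooth_v := sv
  smooth_w := sw
  u_diag x hx i := by rw [((hu x hx i).diag (hγ x hx i)).eq, ← sub_eq_add_neg]
  u_offdiag x hx i j hij := ((hu x hx j).offdiag hij).eq
  v_diag x hx i := by rw [((hv x hx i).diag (hγ x hx i)).eq, ← add_sub_assoc]
  v_offdiag x hx i j hij := ((hv x hx j).offdiag hij).eq
  w_eq x hx i := (hw x hx i).eq

theorem OmegaSystem.hasRotPd {ω : Coord n → Matrix (Fin n) (Fin n) ℝ} (h : OmegaSystem U γ ω)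
    (hγ : ∀ x ∈ U, ∀ i, γ i i x = 0) (hU : IsOpen U) (hx : x ∈ U) (j α : Fin n) :
    HasRotPd γ j (fun i y => ω y i α) 0 x :=
  .of_cases (hγ x hx j)
    (by rw [add_zero]; exact SmoothOn.hasPd_of_eq (h.smooth j α) hU hx (h.diag x hx j α))
    fun i hi => SmoothOn.hasPd_of_eq (h.smooth i α) hU hx (eq_neg_of_add_eq_zero_left
      (h.offdiag x hx i j α hi))

theorem OmegaSystem.of_hasRotPd {ω : Coord n → Matrix (Fin n) (Fin n) ℝ}
    (hγ : ∀ x ∈ U, ∀ i, γ i i x = 0) (hs : ∀ i α, SmoothOn U (fun x => ω x i α))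
    (ho : ∀ x ∈ U, ω x ∈ Matrix.orthogonalGroup (Fin n) ℝ)
    (h : ∀ x ∈ U, ∀ j α, HasRotPd γ j (fun i y => ω y i α) 0 x) : OmegaSystem U γ ω where
  smooth := hs
  orthogonal := ho
  offdiag x hx i j α hij := by rw [((h x hx j α).offdiag hij).eq]; simp
  diag x hx i α := by rw [((h x hx i α).diag (hγ x hx i)).eq]; simp

end Lax

/-! ### The real form of the Darboux data -/

namespace IsDarbouxData

variable {n : ℕ} {K : ℝ} {U : Set (Coord n)} {ρ : Fin n → Coord n → ℝ}
  {γ : Fin n → Fin n → Coord n → ℝ} {μ : ℝ} {ξ η : Fin n → Coord n → ℝ} {ζ : Coord n → ℝ}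
  {x : Coord n}

theorem smooth_xi (h : IsDarbouxData K U ρ γ μ ξ η ζ) (i : Fin n) : SmoothOn U (ξ i) := by
  simpa [Function.comp_def] using Complex.reCLM.contDiff.comp_contDiffOn (h.lax.smooth_u i)

theorem smooth_eta (h : IsDarbouxData K U ρ γ μ ξ η ζ) (i : Fin n) : SmoothOn U (η i) := by
  simpa [Function.comp_def] using Complex.imCLM.contDiff.comp_contDiffOn (h.lax.smooth_v i)

theorem smooth_zeta (h : IsDarbouxData K U ρ γ μ ξ η ζ) : SmoothOn U ζ := by
  simpa [Function.comp_def] using Complex.imCLM.contDiff.comp_contDiffOn h.lax.smooth_w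

theorem smooth_del (h : IsDarbouxData K U ρ γ μ ξ η ζ) : SmoothOn U (Del ξ) :=
  ContDiffOn.sum fun i _ => (h.smooth_xi i).pow 2

/-- At λ = iμ the inhomogeneous term is -iμ · iη_j = μη_j, so the real part of the complex system is
a real system for ξ. -/
theorem hasRotPd_xi (h : IsDarbouxData K U ρ γ μ ξ η ζ) (hγ : ∀ x ∈ U, ∀ i, γ i i x = 0)
    (hU : IsOpen U) (hx : x ∈ U) (j : Fin n) : HasRotPd γ j ξ (μ * η j x) x := by
  intro i
  refine (((h.lax.hasRotPd_u hγ hU hx j i).clm Complex.reCLM).of_forall fun y => ?_).cast ?_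
  · simp
  · by_cases e : i = j <;> simp [e]

theorem hasRotPd_eta (h : IsDarbouxData K U ρ γ μ ξ η ζ) (hγ : ∀ x ∈ U, ∀ i, γ i i x = 0)
    (hU : IsOpen U) (hx : x ∈ U) (j : Fin n) :
    HasRotPd (fun i k => γ k i) j η (μ * ξ j x - K * ρ j x * ζ x) x := by
  intro i
  refine (((h.lax.hasRotPd_v hγ hU hx j i).clm Complex.imCLM).of_forall fun y => ?_).cast ?_
  · simp
  · by_cases e : i = j <;> simp [e]

theorem hasPd_zeta (h : IsDarbouxData K U ρ γ μ ξ η ζ) (hU : IsOpen U) (hx : x ∈ U) (j : Fin n) :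
    HasPd j ζ (ρ j x * η j x) x := by
  refine (((h.lax.hasPd_w hU hx j).clm Complex.imCLM).of_forall fun y => ?_).cast ?_ <;> simp

theorem hasPd_del (h : IsDarbouxData K U ρ γ μ ξ η ζ) (hγ : ∀ x ∈ U, ∀ i, γ i i x = 0)
    (hU : IsOpen U) (hx : x ∈ U) (j : Fin n) :
    HasPd j (Del ξ) (2 * μ * (ξ j x * η j x)) x := by
  have := h.hasRotPd_xi hγ hU hx j
  refine ((this.sum_smul this).of_forall fun y => ?_).cast ?_
  · simp [Del, sq]
  · simp; ring

/-- The scalar factors 2/Δ, 2μ/Δ and b/Δ of the transformation formulas are all constants divided by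
Δ. Their common derivative rule is the condition on f in `HasRotPd.transform`. -/
theorem hasPd_div_del (h : IsDarbouxData K U ρ γ μ ξ η ζ) (hγ : ∀ x ∈ U, ∀ i, γ i i x = 0)
    (hU : IsOpen U) (hx : x ∈ U) (j : Fin n) (t : ℝ) :
    HasPd j (fun y => t / Del ξ y) (-(t / Del ξ x * (2 * μ / Del ξ x * (ξ j x * η j x)))) x := by
  have h0 := h.del_ne_zero x hx
  refine (((HasPd.const j t x).mul ((h.hasPd_del hγ hU hx j).inv h0)).of_forall
    fun y => div_eq_mul_inv _ _).cast ?_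
  field_simp
  ring

end IsDarbouxData

/-! ### Sums with one or two indices removed -/

section Sums

variable {n : ℕ} {M : Type*} [AddCommGroup M]

theorem sum_erase_eq_left {i j : Fin n} (h : i ≠ j) (f : Fin n → M) :
    ∑ k ∈ Finset.univ.erase i, f k = (∑ k ∈ (Finset.univ.erase i).erase j, f k) + f j :=
  (Finset.sum_erase_add _ _ (by simp [h.symm])).symm

theorem sum_erase_eq_right {i j : Fin n} (h : i ≠ j) (f : Fin n → M) :
    ∑ k ∈ Finset.univ.erase j, f k = (∑ k ∈ (Finset.univ.erase i).erase j, f k) + f i := by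
  rw [Finset.erase_right_comm, sum_erase_eq_left h.symm]

theorem sum_erase_erase {i j : Fin n} (h : i ≠ j) (f : Fin n → M) :
    ∑ k ∈ (Finset.univ.erase i).erase j, f k = ∑ k, f k - f i - f j := by
  rw [← Finset.sum_erase_add _ _ (Finset.mem_univ i), sum_erase_eq_left h]
  abel

end Sums

/-! ### The new solution of (GC) and of (Ω) -/

section NewSolution

variable {n : ℕ} {K : ℝ} {U : Set (Coord n)} {ρ : Fin n → Coord n → ℝ}
  {γ : Fin n → Fin n → Coord n → ℝ} {μ : ℝ} {ξ η : Fin n → Coord n → ℝ} {ζ : Coord n → ℝ}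
  {x : Coord n}

theorem gammaT_of_ne {i j : Fin n} (h : i ≠ j) (x : Coord n) :
    gammaT μ ξ η γ i j x = γ i j x + 2 * μ / Del ξ x * (ξ i x * η j x) := by
  rw [gammaT, if_neg h]; ring

theorem gammaT_self (i : Fin n) (x : Coord n) : gammaT μ ξ η γ i i x = 0 := if_pos rfl

theorem hasPd_gammaT (hD : IsDarbouxData K U ρ γ μ ξ η ζ) (hG : GaussCodazzi K U ρ γ)
    (hU : IsOpen U) (hx : x ∈ U) {i j : Fin n} (h : i ≠ j) {k : Fin n} {a b : ℝ}
    (ha : HasPd k (ξ i) a x) (hb : HasPd k (η j) b x) :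
    HasPd k (gammaT μ ξ η γ i j)
      (pd k (γ i j) x + (-(2 * μ / Del ξ x * (2 * μ / Del ξ x * (ξ k x * η k x)))
        * (ξ i x * η j x) + 2 * μ / Del ξ x * (a * η j x + ξ i x * b))) x :=
  ((SmoothOn.hasPd (hG.smooth_gamma i j) hU hx k).add
    ((hD.hasPd_div_del hG.diag hU hx k (2 * μ)).mul (ha.mul hb))).of_forall (gammaT_of_ne h)

theorem hasPd_rhoT (hD : IsDarbouxData K U ρ γ μ ξ η ζ) (hG : GaussCodazzi K U ρ γ)
    (hU : IsOpen U) (hx : x ∈ U) {i k : Fin n} {a : ℝ} (ha : HasPd k (ξ i) a x) :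
    HasPd k (rhoT μ ξ ζ ρ i)
      (pd k (ρ i) x - (-(2 * μ / Del ξ x * (2 * μ / Del ξ x * (ξ k x * η k x)))
        * (ζ x * ξ i x) + 2 * μ / Del ξ x * (ρ k x * η k x * ξ i x + ζ x * a))) x :=
  ((SmoothOn.hasPd (hG.smooth_rho i) hU hx k).sub
    ((hD.hasPd_div_del hG.diag hU hx k (2 * μ)).mul
      ((hD.hasPd_zeta hU hx k).mul ha))).of_forall fun y => by rw [rhoT]; ring

theorem smoothOn_rhoT (hD : IsDarbouxData K U ρ γ μ ξ η ζ) (hG : GaussCodazzi K U ρ γ)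
    (i : Fin n) : SmoothOn U (rhoT μ ξ ζ ρ i) :=
  (hG.smooth_rho i).sub ((((contDiffOn_const (c := 2 * μ)).mul hD.smooth_zeta).mul
    (hD.smooth_xi i)).div hD.smooth_del hD.del_ne_zero)

theorem smoothOn_gammaT (hD : IsDarbouxData K U ρ γ μ ξ η ζ) (hG : GaussCodazzi K U ρ γ)
    (i j : Fin n) : SmoothOn U (gammaT μ ξ η γ i j) := by
  by_cases h : i = j
  · subst h
    exact (contDiffOn_const (c := (0 : ℝ))).congr fun x _ => gammaT_self i x
  · exact ((hG.smooth_gamma i j).add (((contDiffOn_const (c := 2 * μ)).div hD.smooth_del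
      hD.del_ne_zero).mul ((hD.smooth_xi i).mul (hD.smooth_eta j)))).congr
      fun x _ => gammaT_of_ne h x

/-- A direct verification, with the derivatives of ξ, η, ζ replaced by their equations. With c =
2μ/Δ, the terms linear in γ cancel against the cross terms of the sums, and the remaining ones
cancel because cΔ = 2μ. -/
theorem gaussCodazzi_transform (hU : IsOpen U) (hG : GaussCodazzi K U ρ γ)
    (hD : IsDarbouxData K U ρ γ μ ξ η ζ) :
    GaussCodazzi K U (rhoT μ ξ ζ ρ) (gammaT μ ξ η γ) where
  smooth_rho := smoothOn_rhoT hD hG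
  smooth_gamma := smoothOn_gammaT hD hG
  diag x _ i := gammaT_self i x
  eq₁ x hx i j hij := by
    have hξ := fun k => hD.hasRotPd_xi hG.diag hU hx k
    have hη := fun k => hD.hasRotPd_eta hG.diag hU hx k
    rw [(hasPd_gammaT hD hG hU hx hij ((hξ i).diag (hG.diag x hx i)) ((hη i).offdiag hij.symm)).eq,
      (hasPd_gammaT hD hG hU hx hij.symm ((hξ j).diag (hG.diag x hx j)) ((hη j).offdiag hij)).eq,
      sum_erase_eq_left hij, sum_erase_eq_right hij]
    have hsum : ∑ l ∈ (Finset.univ.erase i).erase j, gammaT μ ξ η γ l i x * gammaT μ ξ η γ l j x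
        = (∑ l ∈ (Finset.univ.erase i).erase j, γ l i x * γ l j x)
          + 2 * μ / Del ξ x * η j x * (∑ l ∈ (Finset.univ.erase i).erase j, γ l i x • ξ l x)
          + 2 * μ / Del ξ x * η i x * (∑ l ∈ (Finset.univ.erase i).erase j, γ l j x • ξ l x)
          + (2 * μ / Del ξ x) ^ 2 * η i x * η j x *
            (∑ l ∈ (Finset.univ.erase i).erase j, ξ l x ^ 2) := by
      simp only [Finset.mul_sum, ← Finset.sum_add_distrib]
      refine Finset.sum_congr rfl fun l hl => ?_
      simp only [Finset.mem_erase] at hl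
      rw [gammaT_of_ne hl.2.1, gammaT_of_ne hl.1, smul_eq_mul, smul_eq_mul]
      ring
    have hsq := sum_erase_erase hij fun l => ξ l x ^ 2
    rw [← Del] at hsq
    have hc : 2 * μ / Del ξ x * Del ξ x = 2 * μ := div_mul_cancel₀ _ (hD.del_ne_zero x hx)
    have h1 := hG.eq₁ x hx i j hij
    rw [hsum, hsq]
    simp only [smul_eq_mul]
    generalize 2 * μ / Del ξ x = c at *
    linear_combination h1 - c * η i x * η j x * hc
  eq₂ x hx i j k hij hik hjk := by
    have hξ := hD.hasRotPd_xi hG.diag hU hx k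
    have hη := hD.hasRotPd_eta hG.diag hU hx k
    rw [(hasPd_gammaT hD hG hU hx hij (hξ.offdiag hik) (hη.offdiag hjk)).eq,
      gammaT_of_ne hik, gammaT_of_ne hjk.symm]
    have h1 := hG.eq₂ x hx i j k hij hik hjk
    simp only [smul_eq_mul]
    linear_combination h1
  eq₃ x hx i j hij := by
    have hξ := fun k => hD.hasRotPd_xi hG.diag hU hx k
    have hη := fun k => hD.hasRotPd_eta hG.diag hU hx k
    rw [(hasPd_gammaT hD hG hU hx hij.symm ((hξ i).offdiag hij.symm)
        ((hη i).diag (hG.diag x hx i))).eq,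
      (hasPd_gammaT hD hG hU hx hij ((hξ j).offdiag hij) ((hη j).diag (hG.diag x hx j))).eq,
      sum_erase_eq_left hij, sum_erase_eq_right hij]
    have hsum : ∑ l ∈ (Finset.univ.erase i).erase j, gammaT μ ξ η γ i l x * gammaT μ ξ η γ j l x
        = (∑ l ∈ (Finset.univ.erase i).erase j, γ i l x * γ j l x)
          + 2 * μ / Del ξ x * ξ j x * (∑ l ∈ (Finset.univ.erase i).erase j, γ i l x • η l x)
          + 2 * μ / Del ξ x * ξ i x * (∑ l ∈ (Finset.univ.erase i).erase j, γ j l x • η l x)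
          + (2 * μ / Del ξ x) ^ 2 * ξ i x * ξ j x *
            (∑ l ∈ (Finset.univ.erase i).erase j, η l x ^ 2) := by
      simp only [Finset.mul_sum, ← Finset.sum_add_distrib]
      refine Finset.sum_congr rfl fun l hl => ?_
      simp only [Finset.mem_erase] at hl
      rw [gammaT_of_ne hl.2.1.symm, gammaT_of_ne hl.1.symm, smul_eq_mul, smul_eq_mul]
      ring
    have hsq := sum_erase_erase hij fun l => η l x ^ 2
    -- Only this equation needs the quadric: Σ η_l² falls short of Δ by Kζ², and the product of the
    -- new ρ_i and ρ_j supplies the missing c²Kζ²ξ_iξ_j.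
    have hq := hD.quadric x hx
    rw [← Del] at hq
    have hc : 2 * μ / Del ξ x * Del ξ x = 2 * μ := div_mul_cancel₀ _ (hD.del_ne_zero x hx)
    have h1 := hG.eq₃ x hx i j hij
    have hρ : ∀ k, rhoT μ ξ ζ ρ k x = ρ k x - 2 * μ / Del ξ x * (ζ x * ξ k x) := fun k => by
      rw [rhoT]; ring
    rw [hsum, hsq, hρ, hρ]
    simp only [smul_eq_mul]
    generalize 2 * μ / Del ξ x = c at *
    linear_combination h1 - c * ξ i x * ξ j x * hc + c ^ 2 * ξ i x * ξ j x * hq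
  eq₄ x hx i j hij := by
    have hξ := hD.hasRotPd_xi hG.diag hU hx j
    rw [(hasPd_rhoT hD hG hU hx (hξ.offdiag hij)).eq, gammaT_of_ne hij, rhoT]
    simp only [smul_eq_mul]
    linear_combination hG.eq₄ x hx i j hij

theorem omegaT_eq_mul (ω : Coord n → Matrix (Fin n) (Fin n) ℝ) (x : Coord n) :
    omegaT ξ ω x =
      (1 - (2 / Del ξ x) • Matrix.vecMulVec (fun i => ξ i x) (fun i => ξ i x)) * ω x := by
  ext i α
  rw [sub_mul, one_mul, smul_mul_assoc]
  simp only [omegaT, Matrix.of_apply, Matrix.sub_apply, Matrix.smul_apply, Matrix.mul_apply,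
    Matrix.vecMulVec_apply, smul_eq_mul, Finset.mul_sum]
  congr 1
  exact Finset.sum_congr rfl fun j _ => by ring

/-- Since ξ · ξ = Δ, the matrix is the reflection in the hyperplane orthogonal to ξ. -/
theorem reflection_mem_orthogonalGroup (h : Del ξ x ≠ 0) :
    (1 - (2 / Del ξ x) • Matrix.vecMulVec (fun i => ξ i x) (fun i => ξ i x) :
      Matrix (Fin n) (Fin n) ℝ) ∈ Matrix.orthogonalGroup (Fin n) ℝ := by
  rw [Matrix.mem_orthogonalGroup_iff]
  have hv : (fun i => ξ i x) ⬝ᵥ (fun i => ξ i x) = Del ξ x := by simp [dotProduct, Del, sq]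
  rw [Matrix.transpose_sub, Matrix.transpose_one, Matrix.transpose_smul,
    Matrix.transpose_vecMulVec, sub_mul, mul_sub, mul_sub, smul_mul_smul_comm,
    Matrix.vecMulVec_mul_vecMulVec, hv, one_mul, mul_one, one_mul, Matrix.vecMulVec_smul, smul_smul]
  have : 2 / Del ξ x * (2 / Del ξ x) * Del ξ x = 2 / Del ξ x + 2 / Del ξ x := by
    field_simp; norm_num
  rw [this, add_smul]
  abel

theorem omegaSystem_transform (hU : IsOpen U) (hG : GaussCodazzi K U ρ γ)
    (hD : IsDarbouxData K U ρ γ μ ξ η ζ) {ω : Coord n → Matrix (Fin n) (Fin n) ℝ}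
    (hω : OmegaSystem U γ ω) : OmegaSystem U (gammaT μ ξ η γ) (omegaT ξ ω) := by
  refine .of_hasRotPd (fun x _ i => gammaT_self i x) (fun i α => ?_) (fun x hx => ?_)
    fun x hx j α => ?_
  · exact (hω.smooth i α).sub (ContDiffOn.sum fun j _ =>
      ((((contDiffOn_const (c := (2 : ℝ))).mul (hD.smooth_xi i)).mul (hD.smooth_xi j)).div
        hD.smooth_del hD.del_ne_zero).mul (hω.smooth j α))
  · rw [omegaT_eq_mul]
    exact mul_mem (reflection_mem_orthogonalGroup (hD.del_ne_zero x hx)) (hω.orthogonal x hx)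
  · have h0 := hD.del_ne_zero x hx
    have hω' := hω.hasRotPd hG.diag hU hx j α
    have hξ := hD.hasRotPd_xi hG.diag hU hx j
    -- Here f = 2/Δ and S = Σ ξ_k ω_kα. The system for ω is homogeneous, so ∂_j S = μη_j ω_jα,
    -- whence t = 2μη_j/Δ. The three terms left in the new inhomogeneity cancel.
    refine ((hω'.transform (γ' := gammaT μ ξ η γ) (t := 2 * μ / Del ξ x * η j x) hξ
      ((hD.hasPd_div_del hG.diag hU hx j 2).cast (by ring)) (hξ.sum_smul hω') ?_
      (hG.diag x hx j) fun i => ?_).of_forall fun i y => ?_).cast ?_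
    · simp only [smul_eq_mul]; ring
    · by_cases h : i = j
      · simp [h, gammaT_self]
      · rw [if_neg h, gammaT_of_ne h]; ring
    · simp only [omegaT, Matrix.of_apply, smul_eq_mul, Finset.mul_sum]
      congr 1
      exact Finset.sum_congr rfl fun j _ => by ring
    · rw [← Del]
      simp only [smul_eq_mul]
      field_simp
      ring

end NewSolution

/-! ### Orthonormal frames adapted to the space form -/

section AdaptedFrames

variable {n : ℕ} {K : ℝ}

/-- `r` lies on `M_{2n}(K)`, and `p₁, …, pₙ, q₁, …, qₙ` is an orthonormal basis of the tangent
space at `r`. -/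
structure IsAdaptedFrame (K : ℝ) (p q : Fin n → Ambient n) (r : Ambient n) : Prop where
  mem : r ∈ spaceForm n K
  p_tangent : ∀ i, p i ∈ spaceFormTangent K r
  q_tangent : ∀ i, q i ∈ spaceFormTangent K r
  inner_pp : ∀ i j, ambientForm K (p i) (p j) = if i = j then 1 else 0
  inner_qq : ∀ i j, ambientForm K (q i) (q j) = if i = j then 1 else 0
  inner_pq : ∀ i j, ambientForm K (p i) (q j) = 0

theorem IsMovingFrame.isAdaptedFrame {U : Set (Coord n)} {ρ : Fin n → Coord n → ℝ}
    {γ : Fin n → Fin n → Coord n → ℝ} {p q : Fin n → Coord n → Ambient n} {r : Coord n → Ambient n}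
    (h : IsMovingFrame K U ρ γ p q r) {x : Coord n} (hx : x ∈ U) :
    IsAdaptedFrame K (fun i => p i x) (fun i => q i x) (r x) :=
  ⟨h.mem x hx, h.p_tangent x hx, h.q_tangent x hx, h.inner_pp x hx, h.inner_qq x hx,
    h.inner_pq x hx⟩

theorem IsMovingFrame.of_isAdaptedFrame {U : Set (Coord n)} {ρ : Fin n → Coord n → ℝ}
    {γ : Fin n → Fin n → Coord n → ℝ} {p q : Fin n → Coord n → Ambient n} {r : Coord n → Ambient n}
    (hl : LaxSystem K U ρ γ (1 : ℝ) p q r)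
    (h : ∀ x ∈ U, IsAdaptedFrame K (fun i => p i x) (fun i => q i x) (r x)) :
    IsMovingFrame K U ρ γ p q r :=
  ⟨hl, fun x hx => (h x hx).mem, fun x hx => (h x hx).p_tangent, fun x hx => (h x hx).q_tangent,
    fun x hx => (h x hx).inner_pp, fun x hx => (h x hx).inner_qq, fun x hx => (h x hx).inner_pq⟩

/-- The factor K treats all three geometries at once: for K = 0 a tangent vector need not be
orthogonal to the position vector. -/
theorem mul_ambientForm_of_tangent {y X : Ambient n} (h : X ∈ spaceFormTangent K y) :
    K * ambientForm K y X = 0 := by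
  by_cases h0 : K = 0
  · rw [h0, zero_mul]
  · rw [ambientForm_apply, h.2 h0, mul_zero]

theorem mul_ambientForm_of_mem {y : Ambient n} (h : y ∈ spaceForm n K) :
    K * ambientForm K y y = K * K := by
  by_cases h0 : K = 0
  · rw [h0, zero_mul, zero_mul]
  · rw [ambientForm_apply, h.2 h0]

theorem linearIndependent_of_orthogonal {E ι : Type*} [AddCommGroup E] [Module ℝ E] [Fintype ι]
    [DecidableEq ι] (B : E →ₗ[ℝ] E →ₗ[ℝ] ℝ) {v : ι → E} {ε : ι → ℝ}
    (h : ∀ a b, B (v a) (v b) = if a = b then ε a else 0) (hε : ∀ a, ε a ≠ 0) :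
    LinearIndependent ℝ v := by
  rw [Fintype.linearIndependent_iff]
  intro c hc a
  have : B (v a) (∑ b, c b • v b) = c a * ε a := by simp [h]
  rw [hc, map_zero] at this
  exact (mul_eq_zero.1 this.symm).resolve_right (hε a)

theorem eq_zero_of_orthogonal_basis {E ι : Type*} [AddCommGroup E] [Module ℝ E]
    [FiniteDimensional ℝ E] [Fintype ι] [Nonempty ι] [DecidableEq ι] (B : E →ₗ[ℝ] E →ₗ[ℝ] ℝ)
    {v : ι → E} {ε : ι → ℝ} (hcard : Fintype.card ι = Module.finrank ℝ E)
    (h : ∀ a b, B (v a) (v b) = if a = b then ε a else 0) (hε : ∀ a, ε a ≠ 0) {X : E}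
    (hX : ∀ a, B (v a) X = 0) : X = 0 := by
  have hX' : X ∈ Submodule.span ℝ (Set.range v) := by
    rw [(linearIndependent_of_orthogonal B h hε).span_eq_top_of_card_eq_finrank hcard]
    trivial
  obtain ⟨c, rfl⟩ := (Submodule.mem_span_range_iff_exists_fun ℝ).1 hX'
  refine Finset.sum_eq_zero fun a _ => ?_
  have : B (v a) (∑ b, c b • v b) = c a * ε a := by simp [h]
  rw [hX a] at this
  rw [(mul_eq_zero.1 this.symm).resolve_right (hε a), zero_smul]

/-- The tangent space of `M_{2n}(K)` at `y` as a subspace. -/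
def tangentSubmodule (K : ℝ) (y : Ambient n) : Submodule ℝ (Ambient n) where
  carrier := spaceFormTangent K y
  add_mem' {a b} ha hb := ⟨fun h => by simp [ha.1 h, hb.1 h], fun h => by
    rw [← ambientForm_apply, map_add, ambientForm_apply, ambientForm_apply, ha.2 h, hb.2 h,
      add_zero]⟩
  zero_mem' := ⟨fun _ => rfl, fun _ => by rw [← ambientForm_apply, map_zero]⟩
  smul_mem' c a ha := ⟨fun h => by simp [ha.1 h], fun h => by
    rw [← ambientForm_apply, map_smul, ambientForm_apply, ha.2 h, smul_zero]⟩

namespace IsAdaptedFrame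

variable {p q : Fin n → Ambient n} {r : Ambient n}

theorem inner_qp (h : IsAdaptedFrame K p q r) (i j : Fin n) : ambientForm K (q i) (p j) = 0 := by
  rw [ambientForm_comm, h.inner_pq]

/-- One more vector completes p, q to an orthogonal basis of the ambient space: the unit normal of
the hyperplane for K = 0, and r, of square K, otherwise. Identities between tangent vectors can thus
be tested against p and q alone. -/
theorem eq_zero (h : IsAdaptedFrame K p q r) {X : Ambient n} (hX : X ∈ spaceFormTangent K r)
    (hp : ∀ i, ambientForm K (p i) X = 0) (hq : ∀ i, ambientForm K (q i) X = 0) : X = 0 := by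
  have hcard : Fintype.card (Idx n) = Module.finrank ℝ (Ambient n) := by simp; ring
  by_cases h0 : K = 0
  · have hN : ∀ Y : Ambient n, ambientForm K (Pi.single (Fin.last (2 * n)) 1) Y
        = Y (Fin.last (2 * n)) := by
      intro Y
      simp [ambientForm_apply, ambientInner, h0, (Fin.castSucc_lt_last _).ne]
    refine eq_zero_of_orthogonal_basis (ambientForm K)
      (v := column p q (Pi.single (Fin.last (2 * n)) 1)) (ε := fun _ => 1) hcard ?_ (by simp) ?_
    · rintro (a | a | a) (b | b | b) <;>
        simp [column, h.inner_pp, h.inner_qq, h.inner_pq, h.inner_qp, hN,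
          ambientForm_comm _ _ (Pi.single (Fin.last (2 * n)) (1 : ℝ)),
          (h.p_tangent _).1 h0, (h.q_tangent _).1 h0]
    · rintro (a | a | a) <;> simp [column, hp, hq, hN, hX.1 h0]
  · have hp' : ∀ i, ambientForm K r (p i) = 0 := fun i => (h.p_tangent i).2 h0
    have hq' : ∀ i, ambientForm K r (q i) = 0 := fun i => (h.q_tangent i).2 h0
    have hr : ambientForm K r r = K := h.mem.2 h0
    refine eq_zero_of_orthogonal_basis (ambientForm K)
      (v := column p q r) (ε := column 1 1 K) hcard ?_ ?_ ?_
    · rintro (a | a | a) (b | b | b) <;>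
        simp [column, h.inner_pp, h.inner_qq, h.inner_pq, h.inner_qp, hr, hp', hq',
          ambientForm_comm _ _ r]
    · rintro (a | a | a) <;> simp [column, h0]
    · have hX' : ambientForm K r X = 0 := hX.2 h0
      rintro (a | a | a) <;> simp [column, hp, hq, hX']

/-- The pointwise Darboux transformation of an adapted frame. -/
theorem darboux (h : IsAdaptedFrame K p q r) (hK : K * K * K = K) {ξ η : Fin n → ℝ} {ζ μ d D : ℝ}
    (hξ : ∑ i, ξ i ^ 2 = D) (hη : ∑ i, η i ^ 2 + K * ζ ^ 2 = D) (hd : d * (1 + μ ^ 2) * D = 2 * μ)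
    {P Q : Ambient n} (hP : P = ∑ i, ξ i • p i) (hQ : Q = ∑ i, η i • q i + (K * ζ) • r) :
    IsAdaptedFrame K (fun i => p i - (d * ξ i) • (μ • P + Q))
      (fun i => q i + (d * η i) • (P - μ • Q)) (r + (d * ζ) • (P - μ • Q)) := by
  -- The map X ↦ X - d⟨X,P⟩(μP + Q) + d⟨X,Q⟩(P - μQ) sends p_i, q_i and, if K ≠ 0, also r to the new
  -- vectors. As P and Q are orthogonal with square D and dD = 2μ/(1 + μ²), for D ≠ 0 it is the
  -- rotation in their plane with cosine (1 - μ²)/(1 + μ²) and sine of absolute value 2|μ|/(1 + μ²).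
  -- The proof tabulates the inner products with P and Q.
  have krp : ∀ i, K * ambientForm K r (p i) = 0 := fun i =>
    mul_ambientForm_of_tangent (h.p_tangent i)
  have krq : ∀ i, K * ambientForm K r (q i) = 0 := fun i =>
    mul_ambientForm_of_tangent (h.q_tangent i)
  have krr := mul_ambientForm_of_mem h.mem
  have pP : ∀ i, ambientForm K (p i) P = ξ i := fun i => by simp [hP, h.inner_pp]
  have qP : ∀ i, ambientForm K (q i) P = 0 := fun i => by simp [hP, h.inner_qp]
  have pQ : ∀ i, ambientForm K (p i) Q = 0 := fun i => by
    have := krp i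
    rw [ambientForm_comm] at this
    simp only [hQ, map_add, map_sum, map_smul, h.inner_pq, smul_eq_mul, mul_zero,
      Finset.sum_const_zero]
    linear_combination ζ * this
  have qQ : ∀ i, ambientForm K (q i) Q = η i := fun i => by
    have := krq i
    rw [ambientForm_comm] at this
    simp only [hQ, map_add, map_sum, map_smul, h.inner_qq, smul_eq_mul, mul_ite, mul_one, mul_zero,
      Finset.sum_ite_eq, Finset.mem_univ, if_true]
    linear_combination ζ * this
  have rP : K * ambientForm K r P = 0 := by
    simp only [hP, map_sum, map_smul, smul_eq_mul, Finset.mul_sum]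
    exact Finset.sum_eq_zero fun i _ => by rw [mul_left_comm, krp, mul_zero]
  have rQ : K * ambientForm K r Q = K * ζ := by
    have : K * ∑ i, η i * ambientForm K r (q i) = 0 := by
      rw [Finset.mul_sum]
      exact Finset.sum_eq_zero fun i _ => by rw [mul_left_comm, krq, mul_zero]
    simp only [hQ, map_add, map_sum, map_smul, smul_eq_mul]
    -- The term Kζ r of Q contributes K³ζ, which is Kζ because K is 0, 1 or -1.
    linear_combination this + K * ζ * krr + ζ * hK
  have PP : ambientForm K P P = D := by
    nth_rewrite 1 [hP]
    simp only [map_sum, map_smul, LinearMap.sum_apply, LinearMap.smul_apply, pP, smul_eq_mul, ← sq,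
      hξ]
  have PQ : ambientForm K P Q = 0 := by
    rw [hP]
    simp [pQ]
  have QP : ambientForm K Q P = 0 := by rw [ambientForm_comm, PQ]
  have QQ : ambientForm K Q Q = D := by
    nth_rewrite 1 [hQ]
    simp only [map_add, map_sum, map_smul, LinearMap.add_apply, LinearMap.sum_apply,
      LinearMap.smul_apply, qQ, smul_eq_mul, ← sq]
    linear_combination ζ * rQ + hη
  have Pp : ∀ i, ambientForm K P (p i) = ξ i := fun i => by rw [ambientForm_comm, pP]
  have Pq : ∀ i, ambientForm K P (q i) = 0 := fun i => by rw [ambientForm_comm, qP]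
  have Qp : ∀ i, ambientForm K Q (p i) = 0 := fun i => by rw [ambientForm_comm, pQ]
  have Qq : ∀ i, ambientForm K Q (q i) = η i := fun i => by rw [ambientForm_comm, qQ]
  have Pr : K * ambientForm K P r = 0 := by rw [ambientForm_comm, rP]
  have Qr : K * ambientForm K Q r = K * ζ := by rw [ambientForm_comm, rQ]
  -- For K = 0, position and tangency only require a vanishing last coordinate.
  have last : ∀ h0 : K = 0, P (Fin.last (2 * n)) = 0 ∧ Q (Fin.last (2 * n)) = 0 := by
    intro h0
    have hp := fun i => (h.p_tangent i).1 h0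
    have hq := fun i => (h.q_tangent i).1 h0
    constructor
    · simp [hP, hp]
    · simp [hQ, hq, h0]
  refine ⟨⟨fun h0 => ?_, fun h0 => ?_⟩, fun i => ⟨fun h0 => ?_, fun h0 => ?_⟩,
    fun i => ⟨fun h0 => ?_, fun h0 => ?_⟩, fun i j => ?_, fun i j => ?_, fun i j => ?_⟩
  · simp [(last h0).1, (last h0).2, h.mem.1 h0]
  · rw [← ambientForm_apply]
    -- Products with r were tabulated with a factor K, which is nonzero here.
    apply mul_left_cancel₀ h0
    simp only [map_add, map_sub, map_smul, LinearMap.add_apply, LinearMap.sub_apply,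
      LinearMap.smul_apply, smul_eq_mul, PP, PQ, QP, QQ]
    linear_combination krr + d * ζ * (rP - μ * rQ) + d * ζ * (Pr - μ * Qr) + K * d * ζ ^ 2 * hd
  · simp [(last h0).1, (last h0).2, (h.p_tangent i).1 h0]
  · rw [← ambientForm_apply]
    apply mul_left_cancel₀ h0
    simp only [map_add, map_sub, map_smul, LinearMap.add_apply, LinearMap.sub_apply,
      LinearMap.smul_apply, smul_eq_mul, PP, PQ, QP, QQ, Pp, Qp]
    linear_combination krp i - d * ξ i * (μ * rP + rQ)
  · simp [(last h0).1, (last h0).2, (h.q_tangent i).1 h0]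
  · rw [← ambientForm_apply]
    apply mul_left_cancel₀ h0
    simp only [map_add, map_sub, map_smul, LinearMap.add_apply, LinearMap.sub_apply,
      LinearMap.smul_apply, smul_eq_mul, PP, PQ, QP, QQ, Pq, Qq]
    linear_combination krq i + d * η i * (rP - μ * rQ) + K * d * ζ * η i * hd
  · simp only [map_add, map_sub, map_smul, LinearMap.add_apply, LinearMap.sub_apply,
      LinearMap.smul_apply, smul_eq_mul, PP, PQ, QP, QQ, Pp, Qp, pP, pQ, h.inner_pp]
    linear_combination d * ξ i * ξ j * hd
  · simp only [map_add, map_sub, map_smul, LinearMap.add_apply, LinearMap.sub_apply,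
      LinearMap.smul_apply, smul_eq_mul, PP, PQ, QP, QQ, Pq, Qq, qP, qQ, h.inner_qq]
    linear_combination d * η i * η j * hd
  · simp only [map_add, map_sub, map_smul, LinearMap.add_apply, LinearMap.sub_apply,
      LinearMap.smul_apply, smul_eq_mul, PP, PQ, QP, QQ, Pq, Qq, pP, pQ, h.inner_pq]
    ring

end IsAdaptedFrame

end AdaptedFrames

/-! ### The transformed frame and its structure equations -/

section FrameTransform

variable {n : ℕ} {K : ℝ} {U : Set (Coord n)} {ρ : Fin n → Coord n → ℝ}
  {γ : Fin n → Fin n → Coord n → ℝ} {μ : ℝ} {ξ η : Fin n → Coord n → ℝ} {ζ : Coord n → ℝ}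
  {p q : Fin n → Coord n → Ambient n} {r : Coord n → Ambient n} {x : Coord n}

/-- `∑ ξⱼ pⱼ`. -/
noncomputable def pSum (ξ : Fin n → Coord n → ℝ) (p : Fin n → Coord n → Ambient n)
    (x : Coord n) : Ambient n :=
  ∑ j, ξ j x • p j x

/-- `∑ ηⱼ qⱼ + K ζ r`. -/
noncomputable def qSum (K : ℝ) (η : Fin n → Coord n → ℝ) (ζ : Coord n → ℝ)
    (q : Fin n → Coord n → Ambient n) (r : Coord n → Ambient n) (x : Coord n) : Ambient n :=
  (∑ j, η j x • q j x) + (K * ζ x) • r x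

/-- All corrections of the frame are multiples of the two vectors μP + Q and P - μQ, with P = `pSum`
and Q = `qSum`; this form fits `HasRotPd.transform`. -/
theorem pT_eq (i : Fin n) (x : Coord n) : pT K μ ξ η ζ p q r i x =
    p i x - (bCoeff μ / Del ξ x * ξ i x) • (μ • pSum ξ p x + qSum K η ζ q r x) := by
  simp only [pT, pSum, qSum, smul_add, Finset.smul_sum, smul_smul]
  have h1 : ∀ j, bCoeff μ * μ * ξ i x * ξ j x / Del ξ x =
    bCoeff μ / Del ξ x * ξ i x * (μ * ξ j x) := fun j => by ring
  have h2 : ∀ j, bCoeff μ * ξ i x * η j x / Del ξ x =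
    bCoeff μ / Del ξ x * ξ i x * η j x := fun j => by ring
  have h3 : K * bCoeff μ * ζ x * ξ i x / Del ξ x =
    bCoeff μ / Del ξ x * ξ i x * (K * ζ x) := by ring
  simp only [h1, h2, h3]
  abel

theorem qT_eq (i : Fin n) (x : Coord n) : qT K μ ξ η ζ p q r i x =
    q i x + (bCoeff μ / Del ξ x * η i x) • (pSum ξ p x - μ • qSum K η ζ q r x) := by
  simp only [qT, pSum, qSum, smul_add, smul_sub, Finset.smul_sum, smul_smul]
  have h1 : ∀ j, bCoeff μ * η i x * ξ j x / Del ξ x =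
    bCoeff μ / Del ξ x * η i x * ξ j x := fun j => by ring
  have h2 : ∀ j, bCoeff μ * μ * η i x * η j x / Del ξ x =
    bCoeff μ / Del ξ x * η i x * (μ * η j x) := fun j => by ring
  have h3 : K * bCoeff μ * μ * ζ x * η i x / Del ξ x =
    bCoeff μ / Del ξ x * η i x * (μ * (K * ζ x)) := by ring
  simp only [h1, h2, h3]
  abel

theorem rT_eq (x : Coord n) : rT K μ ξ η ζ p q r x =
    r x + (bCoeff μ / Del ξ x * ζ x) • (pSum ξ p x - μ • qSum K η ζ q r x) := by
  simp only [rT, pSum, qSum, smul_add, smul_sub, Finset.smul_sum, smul_smul]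
  have h1 : ∀ j, bCoeff μ * ζ x * ξ j x / Del ξ x =
    bCoeff μ / Del ξ x * ζ x * ξ j x := fun j => by ring
  have h2 : ∀ j, bCoeff μ * μ * ζ x * η j x / Del ξ x =
    bCoeff μ / Del ξ x * ζ x * (μ * η j x) := fun j => by ring
  have h3 : K * bCoeff μ * μ * ζ x ^ 2 / Del ξ x =
    bCoeff μ / Del ξ x * ζ x * (μ * (K * ζ x)) := by ring
  simp only [h1, h2, h3]
  abel

theorem bCoeff_mul (μ D : ℝ) : bCoeff μ / D * (1 + μ ^ 2) = 2 * μ / D := by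
  have : 1 + μ ^ 2 ≠ 0 := by positivity
  rw [bCoeff]
  field_simp

theorem hasPd_pSum (hD : IsDarbouxData K U ρ γ μ ξ η ζ) (hγ : ∀ x ∈ U, ∀ i, γ i i x = 0)
    (hU : IsOpen U) (hL : LaxSystem K U ρ γ (1 : ℝ) p q r) (hx : x ∈ U) (j : Fin n) :
    HasPd j (pSum ξ p) ((μ * η j x) • p j x - ξ j x • q j x) x :=
  ((hD.hasRotPd_xi hγ hU hx j).sum_smul (hL.hasRotPd_u hγ hU hx j)).cast (by module)

/-- The summand Kζ r is there to cancel the two curvature terms, one in the equation of η and one in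
that of q. -/
theorem hasPd_qSum (hD : IsDarbouxData K U ρ γ μ ξ η ζ) (hγ : ∀ x ∈ U, ∀ i, γ i i x = 0)
    (hU : IsOpen U) (hL : LaxSystem K U ρ γ (1 : ℝ) p q r) (hx : x ∈ U) (j : Fin n) :
    HasPd j (qSum K η ζ q r) (η j x • p j x + (μ * ξ j x) • q j x) x :=
  (((hD.hasRotPd_eta hγ hU hx j).sum_smul (hL.hasRotPd_v hγ hU hx j)).add
    (((HasPd.const j K x).mul (hD.hasPd_zeta hU hx j)).smul (hL.hasPd_w hU hx j))).cast
    (by module)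

theorem smoothOn_pSum (hD : IsDarbouxData K U ρ γ μ ξ η ζ)
    (hL : LaxSystem K U ρ γ (1 : ℝ) p q r) : SmoothOn U (pSum ξ p) :=
  ContDiffOn.sum fun j _ => (hD.smooth_xi j).smul (hL.smooth_u j)

theorem smoothOn_qSum (hD : IsDarbouxData K U ρ γ μ ξ η ζ)
    (hL : LaxSystem K U ρ γ (1 : ℝ) p q r) : SmoothOn U (qSum K η ζ q r) :=
  (ContDiffOn.sum fun j _ => (hD.smooth_eta j).smul (hL.smooth_v j)).add
    ((contDiffOn_const.mul hD.smooth_zeta).smul hL.smooth_w)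

theorem laxSystem_transform (hU : IsOpen U) (hG : GaussCodazzi K U ρ γ)
    (hD : IsDarbouxData K U ρ γ μ ξ η ζ) (hL : LaxSystem K U ρ γ (1 : ℝ) p q r) :
    LaxSystem K U (rhoT μ ξ ζ ρ) (gammaT μ ξ η γ) (1 : ℝ)
      (pT K μ ξ η ζ p q r) (qT K μ ξ η ζ p q r) (rT K μ ξ η ζ p q r) := by
  have sP := smoothOn_pSum hD hL
  have sQ := smoothOn_qSum hD hL
  have sd : SmoothOn U fun y => bCoeff μ / Del ξ y :=
    contDiffOn_const.div hD.smooth_del hD.del_ne_zero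
  refine .of_hasRotPd (fun x _ i => gammaT_self i x) (fun i => ?_) (fun i => ?_) ?_ ?_ ?_ ?_
  · exact ((hL.smooth_u i).sub ((sd.mul (hD.smooth_xi i)).smul
      (((contDiffOn_const (c := μ)).smul sP).add sQ))).congr fun y _ => pT_eq i y
  · exact ((hL.smooth_v i).add ((sd.mul (hD.smooth_eta i)).smul
      (sP.sub ((contDiffOn_const (c := μ)).smul sQ)))).congr fun y _ => qT_eq i y
  · exact (hL.smooth_w.add ((sd.mul hD.smooth_zeta).smul
      (sP.sub ((contDiffOn_const (c := μ)).smul sQ)))).congr fun y _ => rT_eq y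
  all_goals
    intro x hx j
    have dP := hasPd_pSum hD hG.diag hU hL hx j
    have dQ := hasPd_qSum hD hG.diag hU hL hx j
    have hξ := hD.hasRotPd_xi hG.diag hU hx j
    have hη := hD.hasRotPd_eta hG.diag hU hx j
    have dd := hD.hasPd_div_del hG.diag hU hx j (bCoeff μ)
    have hdc := bCoeff_mul μ (Del ξ x)
    have hq := hD.quadric x hx
    rw [← Del] at hq
    have hc : 2 * μ / Del ξ x * Del ξ x = 2 * μ := div_mul_cancel₀ _ (hD.del_ne_zero x hx)
  -- For p take f = b/Δ and S = μP + Q, whose derivative is (1 + μ²)η_j p_j; since b(1 + μ²) = 2μ,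
  -- this fixes t = 2μη_j/Δ.
  · refine (((hL.hasRotPd_u hG.diag hU hx j).transform (γ' := gammaT μ ξ η γ)
      (t := 2 * μ / Del ξ x * η j x) hξ (dd.cast (by ring))
      (((HasPd.const j μ x).smul dP).add dQ) ?_ (hG.diag x hx j) fun i => ?_).of_forall
      pT_eq).cast ?_
    · rw [← hdc]; module
    · by_cases h : i = j
      · simp [h, gammaT_self]
      · rw [if_neg h, gammaT_of_ne h]; ring
    · rw [qT_eq, ← Del, ← pSum]
      rw [show bCoeff μ / Del ξ x * (2 * μ / Del ξ x * η j x) * Del ξ x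
          = bCoeff μ / Del ξ x * η j x * (2 * μ) by
        linear_combination bCoeff μ / Del ξ x * η j x * hc, ← hdc]
      module
  -- For q the roles of ξ and η are exchanged and γ is transposed: f = -b/Δ, S = P - μQ and t =
  -- 2μξ_j/Δ.
  · refine (((hL.hasRotPd_v hG.diag hU hx j).transform
      (γ' := fun i k => gammaT μ ξ η γ k i) (f := fun y => -(bCoeff μ / Del ξ y))
      (t := 2 * μ / Del ξ x * ξ j x) hη (dd.neg.cast (by ring))
      (dP.sub ((HasPd.const j μ x).smul dQ)) ?_ (hG.diag x hx j) fun i => ?_).of_forall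
      fun i y => ?_).cast ?_
    · rw [← hdc]; module
    · by_cases h : i = j
      · simp [h, gammaT_self]
      · rw [if_neg h, gammaT_of_ne (Ne.symm h)]; ring
    · rw [qT_eq]; module
    · rw [pT_eq, rT_eq, rhoT]
      -- The sums over η lack the ζ parts of Q and of the quadric; these parts produce the new
      -- coefficient of the transformed position vector.
      have hQ : ∑ k, η k x • q k x = qSum K η ζ q r x - (K * ζ x) • r x := by
        rw [qSum, add_sub_cancel_right]
      have hs : ∑ k, η k x ^ 2 = Del ξ x - K * ζ x ^ 2 := by rw [hq]; ring
      have e : -(bCoeff μ / Del ξ x) * (2 * μ / Del ξ x * ξ j x) * (Del ξ x - K * ζ x ^ 2)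
          = -(bCoeff μ / Del ξ x) * ξ j x * (2 * μ)
            + bCoeff μ / Del ξ x * (2 * μ / Del ξ x) * ξ j x * K * ζ x ^ 2 := by
        linear_combination -(bCoeff μ / Del ξ x) * ξ j x * hc
      have e' : ρ j x - 2 * μ * ζ x * ξ j x / Del ξ x
          = ρ j x - 2 * μ / Del ξ x * ζ x * ξ j x := by ring
      rw [hQ, hs, e, e', ← hdc]
      module
  · refine (((hL.hasPd_w hU hx j).add ((dd.mul (hD.hasPd_zeta hU hx j)).smul
      (dP.sub ((HasPd.const j μ x).smul dQ)))).of_forall rT_eq).cast ?_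
    have e' : ρ j x - 2 * μ * ζ x * ξ j x / Del ξ x
        = ρ j x - 2 * μ / Del ξ x * ζ x * ξ j x := by ring
    rw [qT_eq, rhoT, e', ← hdc]
    module

theorem isMovingFrame_transform (hK : K * K * K = K) (hU : IsOpen U) (hG : GaussCodazzi K U ρ γ)
    (hD : IsDarbouxData K U ρ γ μ ξ η ζ) (hF : IsMovingFrame K U ρ γ p q r) :
    IsMovingFrame K U (rhoT μ ξ ζ ρ) (gammaT μ ξ η γ)
      (pT K μ ξ η ζ p q r) (qT K μ ξ η ζ p q r) (rT K μ ξ η ζ p q r) := by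
  refine .of_isAdaptedFrame (laxSystem_transform hU hG hD hF.structure_eq) fun x hx => ?_
  simp only [pT_eq, qT_eq, rT_eq]
  refine (hF.isAdaptedFrame hx).darboux hK rfl (hD.quadric x hx).symm ?_ rfl rfl
  rw [bCoeff_mul]
  exact div_mul_cancel₀ _ (hD.del_ne_zero x hx)

end FrameTransform

/-! ### The Darboux matrix at λ = 0 and λ = 1 -/

section DarbouxMatrix

variable {n : ℕ} {K : ℝ} {U : Set (Coord n)} {ρ : Fin n → Coord n → ℝ}
  {γ : Fin n → Fin n → Coord n → ℝ} {μ : ℝ} {ξ η : Fin n → Coord n → ℝ} {ζ : Coord n → ℝ}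
  {p q : Fin n → Coord n → Ambient n} {r : Coord n → Ambient n} {x : Coord n}

theorem star_vecH_dotProduct (hD : IsDarbouxData K U ρ γ μ ξ η ζ) (hx : x ∈ U) :
    star (vecH ξ η ζ x) ⬝ᵥ (matC n K).mulVec (vecH ξ η ζ x) = 2 * (Del ξ x : ℂ) := by
  have hq := hD.quadric x hx
  rw [← Del] at hq
  -- One copy of Δ comes from ξ, the other from the quadric.
  have h2 : (2 * (Del ξ x : ℂ)) = ((Del ξ x + ((∑ i, η i x ^ 2) + K * ζ x ^ 2) : ℝ) : ℂ) := by
    rw [← hq]; push_cast; ring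
  rw [h2]
  simp only [matC, Matrix.mulVec_diagonal, dotProduct, Fintype.sum_sum_type, column, vecH,
    Pi.star_apply, Sum.elim_inl, Sum.elim_inr, Del, Finset.univ_unique, Finset.sum_singleton]
  have hI : ∀ t : ℝ, star (Complex.I * (t : ℂ)) = -(Complex.I * t) := by intro t; simp
  have hR : ∀ t : ℝ, star (t : ℂ) = t := by intro t; simp
  simp only [hI, hR]
  push_cast
  have e1 : ∀ i, -(Complex.I * (η i x : ℂ)) * (Complex.I * (η i x : ℂ)) = (η i x : ℂ) ^ 2 :=
    fun i => by linear_combination -(η i x : ℂ) ^ 2 * Complex.I_sq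
  have e2 : -(Complex.I * (ζ x : ℂ)) * (K * (Complex.I * (ζ x : ℂ))) = K * (ζ x : ℂ) ^ 2 := by
    linear_combination -(K * (ζ x : ℂ) ^ 2) * Complex.I_sq
  simp only [one_mul, e1, e2, ← sq]

/-- The commutator and anticommutator with the diagonal σ multiply the entries of HH* by σ_a - σ_b
and σ_a + σ_b. So the commutator lives in the blocks mixing ξ with (η, ζ), and the anticommutator in
the other ones. -/
theorem geoDarboux_apply (hD : IsDarbouxData K U ρ γ μ ξ η ζ) (hx : x ∈ U) (lam : ℂ) (a b : Idx n) :
    geoDarboux K μ ξ η ζ lam x a b = 1 / (lam ^ 2 + (μ : ℂ) ^ 2) *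
      ((lam ^ 2 + (μ : ℂ) ^ 2) * (if a = b then 1 else 0)
        + 2 * Complex.I * lam * μ / (2 * (Del ξ x : ℂ)) *
          ((column 1 (-1) (-1) a - column 1 (-1) (-1) b) * vecH ξ η ζ x a * star (vecH ξ η ζ x b)
            * column 1 (-1) (-1) b * column 1 1 (K : ℂ) b)
        - 2 * (μ : ℂ) ^ 2 / (2 * (Del ξ x : ℂ)) *
          ((column 1 (-1) (-1) a + column 1 (-1) (-1) b) * vecH ξ η ζ x a * star (vecH ξ η ζ x b)
            * column 1 (-1) (-1) b * column 1 1 (K : ℂ) b)) := by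
  rw [geoDarboux, darbouxMatrix, star_vecH_dotProduct hD hx]
  simp only [matSigma, matC, Matrix.smul_apply, Matrix.add_apply, Matrix.sub_apply,
    Matrix.mul_diagonal, Matrix.diagonal_mul, Matrix.vecMulVec_apply, smul_eq_mul, Pi.star_apply,
    Matrix.one_apply]
  change _ = 1 / (lam ^ 2 + (μ : ℂ) ^ 2) *
      ((lam ^ 2 + (μ : ℂ) ^ 2) * (if a = b then 1 else 0)
        + 2 * Complex.I * lam * μ / (2 * (Del ξ x : ℂ)) *
          ((column (fun _ => 1) (fun _ => -1) (-1) a - column (fun _ => 1) (fun _ => -1) (-1) b) *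
            vecH ξ η ζ x a * star (vecH ξ η ζ x b) * column (fun _ => 1) (fun _ => -1) (-1) b *
            column (fun _ => 1) (fun _ => 1) (K : ℂ) b)
        - 2 * (μ : ℂ) ^ 2 / (2 * (Del ξ x : ℂ)) *
          ((column (fun _ => 1) (fun _ => -1) (-1) a + column (fun _ => 1) (fun _ => -1) (-1) b) *
            vecH ξ η ζ x a * star (vecH ξ η ζ x b) * column (fun _ => 1) (fun _ => -1) (-1) b *
            column (fun _ => 1) (fun _ => 1) (K : ℂ) b))
  ring

theorem omegaT_eq_geoDarboux (hD : IsDarbouxData K U ρ γ μ ξ η ζ) (hx : x ∈ U) (hμ : μ ≠ 0)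
    (ω : Coord n → Matrix (Fin n) (Fin n) ℝ) (i α : Fin n) :
    ((omegaT ξ ω x i α : ℝ) : ℂ) =
      ∑ j, geoDarboux K μ ξ η ζ 0 x (Sum.inl i) (Sum.inl j) * ((ω x j α : ℝ) : ℂ) := by
  have hμ' : (μ : ℂ) ≠ 0 := by exact_mod_cast hμ
  have h0 : (Del ξ x : ℂ) ≠ 0 := by exact_mod_cast hD.del_ne_zero x hx
  have key : ∀ j, geoDarboux K μ ξ η ζ 0 x (Sum.inl i) (Sum.inl j)
      = (((if i = j then 1 else 0) - 2 * ξ i x * ξ j x / Del ξ x : ℝ) : ℂ) := by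
    intro j
    rw [geoDarboux_apply hD hx]
    by_cases h : i = j <;> simp [column, vecH, h] <;> field_simp <;> ring
  simp only [key, ← Complex.ofReal_mul, ← Complex.ofReal_sum]
  simp [omegaT, sub_mul, Finset.sum_sub_distrib]

/-- The coefficients of `G(1)` are real. -/
theorem geoDarboux_one_apply (hD : IsDarbouxData K U ρ γ μ ξ η ζ) (hx : x ∈ U) (a b : Idx n) :
    geoDarboux K μ ξ η ζ 1 x a b = (((if a = b then 1 else 0) + bCoeff μ / Del ξ x *
      column (fun i => -ξ i x * column (fun j => μ * ξ j x) (fun j => η j x) (K * ζ x) b)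
        (fun i => η i x * column (fun j => ξ j x) (fun j => -(μ * η j x)) (-(μ * (K * ζ x))) b)
        (ζ x * column (fun j => ξ j x) (fun j => -(μ * η j x)) (-(μ * (K * ζ x))) b) a :
          ℝ) : ℂ) := by
  have h1 : (1 : ℂ) + (μ : ℂ) ^ 2 ≠ 0 := by
    have : (1 : ℝ) + μ ^ 2 ≠ 0 := by positivity
    exact_mod_cast this
  have h0 : (Del ξ x : ℂ) ≠ 0 := by exact_mod_cast hD.del_ne_zero x hx
  rw [geoDarboux_apply hD hx, one_pow]
  have e : ∀ s t : ℂ, 1 / (1 + (μ : ℂ) ^ 2) * ((1 + (μ : ℂ) ^ 2) * s + t)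
      = s + 1 / (1 + (μ : ℂ) ^ 2) * t := by
    intro s t; field_simp
  rw [add_sub_assoc, e]
  push_cast
  congr 1
  · by_cases h : a = b <;> simp [h]
  -- In the mixed blocks exactly one factor from H is imaginary, and it combines with the i in 2iλμ
  -- to a real number; in the others there are none or two.
  · rcases a with a | a | a <;> rcases b with b | b | b <;>
      simp [column, vecH, bCoeff] <;> field_simp <;> (try ring_nf) <;> (try simp)

theorem frameT_eq_geoDarboux (hD : IsDarbouxData K U ρ γ μ ξ η ζ) (hx : x ∈ U) (a : Idx n)
    (c : Fin (2 * n + 1)) :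
    ((column (fun i => pT K μ ξ η ζ p q r i x) (fun i => qT K μ ξ η ζ p q r i x)
        (rT K μ ξ η ζ p q r x) a c : ℝ) : ℂ) =
      ∑ b, geoDarboux K μ ξ η ζ 1 x a b *
        ((column (fun i => p i x) (fun i => q i x) (r x) b c : ℝ) : ℂ) := by
  simp only [geoDarboux_one_apply hD hx, ← Complex.ofReal_mul, ← Complex.ofReal_sum]
  congr 1
  simp only [add_mul, Finset.sum_add_distrib, ite_mul, one_mul, zero_mul, Finset.sum_ite_eq,
    Finset.mem_univ, if_true]
  rcases a with a | a | a
  · simp [column, pT_eq, pSum, qSum, Fintype.sum_sum_type, Finset.mul_sum, sub_eq_add_neg,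
      ← Finset.sum_neg_distrib, add_assoc]
    ring_nf
  · simp [column, qT_eq, pSum, qSum, Fintype.sum_sum_type, Finset.mul_sum, sub_eq_add_neg,
      ← Finset.sum_neg_distrib]
    ring_nf
  · simp [column, rT_eq, pSum, qSum, Fintype.sum_sum_type, Finset.mul_sum, sub_eq_add_neg,
      ← Finset.sum_neg_distrib]
    ring_nf

end DarbouxMatrix

/-! ### The new position vector in terms of the old one -/

section Position

variable {n : ℕ} {K : ℝ} {U : Set (Coord n)} {ρ : Fin n → Coord n → ℝ}
  {γ : Fin n → Fin n → Coord n → ℝ} {μ : ℝ} {ξ η : Fin n → Coord n → ℝ} {ζ : Coord n → ℝ}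
  {p q : Fin n → Coord n → Ambient n} {r : Coord n → Ambient n} {x : Coord n}

theorem hasPd_pd_position (hG : GaussCodazzi K U ρ γ) (hL : LaxSystem K U ρ γ (1 : ℝ) p q r)
    (hU : IsOpen U) (hx : x ∈ U) (i j : Fin n) :
    HasPd i (pd j r) (pd i (ρ j) x • q j x + ρ j x • (-(γ i j x • q i x)
      + if j = i then (∑ k, γ i k x • q k x) + (p i x - (K * ρ i x) • r x) else 0)) x := by
  refine (((SmoothOn.hasPd (hG.smooth_rho j) hU hx i).smul
    (hL.hasRotPd_v hG.diag hU hx i j)).congr_on hU hx fun y hy => hL.w_eq y hy j).cast ?_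
  rw [one_smul]

/-- Where ρ_j ≠ 0, the equations for ∂_j V and ∂_j² V can be solved for q_j and p_j. -/
theorem rT_eq_positionT (hU : IsOpen U) (hG : GaussCodazzi K U ρ γ)
    (hL : LaxSystem K U ρ γ (1 : ℝ) p q r) (hx : x ∈ U) (hρ : ∀ i, ρ i x ≠ 0) :
    rT K μ ξ η ζ p q r x = positionT K μ ξ η ζ ρ r x := by
  have h1 : ∀ j, pd j r x = ρ j x • q j x := hL.w_eq x hx
  have h2 := fun j => (hasPd_pd_position hG hL hU hx j j).eq
  have h3 : ∀ j, ∑ k ∈ Finset.univ.erase j, ξ k x * pd j (ρ k) x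
      = -((∑ k, γ k j x * ξ k x) * ρ j x) := by
    intro j
    rw [Finset.sum_mul, ← Finset.sum_erase (s := Finset.univ) (a := j)
      (by rw [hG.diag x hx, zero_mul, zero_mul]),
      ← Finset.sum_neg_distrib]
    refine Finset.sum_congr rfl fun k hk => ?_
    linear_combination ξ k x * hG.eq₄ x hx k j (Finset.ne_of_mem_erase hk)
  have key : ∀ j, (bCoeff μ * ζ x * ξ j x / (Del ξ x * ρ j x)) • pd j (pd j r) x
      + (bCoeff μ * ζ x / (Del ξ x * ρ j x ^ 2) *
        (-(ξ j x * pd j (ρ j) x) + (∑ k ∈ Finset.univ.erase j, ξ k x * pd j (ρ k) x)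
          - μ * ρ j x * η j x)) • pd j r x
      = (bCoeff μ * ζ x / Del ξ x) • ((∑ k, (ξ j x * γ j k x) • q k x)
          - (∑ k, γ k j x * ξ k x) • q j x)
        + (bCoeff μ / Del ξ x * ζ x) • (ξ j x • p j x - μ • (η j x • q j x))
        - (K * bCoeff μ * ζ x * ρ j x * ξ j x / Del ξ x) • r x := by
    intro j
    simp only [mul_smul (ξ j x), ← Finset.smul_sum]
    rw [h1, h2, h3, if_pos rfl, hG.diag x hx]
    generalize ∑ k, γ j k x • q k x = W
    generalize ∑ k, γ k j x * ξ k x = Z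
    have := hρ j
    have e1 : bCoeff μ * ζ x * ξ j x / (Del ξ x * ρ j x)
        = bCoeff μ * ζ x * ξ j x / Del ξ x * (ρ j x)⁻¹ := by
      rw [div_mul_eq_div_div, div_eq_mul_inv]
    have e2 : bCoeff μ * ζ x / (Del ξ x * ρ j x ^ 2)
        = bCoeff μ * ζ x / Del ξ x * (ρ j x)⁻¹ * (ρ j x)⁻¹ := by
      rw [div_mul_eq_div_div, sq, div_mul_eq_div_div, div_eq_mul_inv, div_eq_mul_inv _ (ρ j x)]
    rw [e1, e2]
    match_scalars <;> field_simp
    ring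
  -- The γ terms from the second derivatives and those from ∂_j ρ_k do not cancel for each j, but
  -- only after summation, by exchanging the two indices.
  have hcancel : ∑ j, ((∑ k, (ξ j x * γ j k x) • q k x) - (∑ k, γ k j x * ξ k x) • q j x) = 0 := by
    rw [Finset.sum_sub_distrib, Finset.sum_comm, sub_eq_zero]
    refine Finset.sum_congr rfl fun k _ => ?_
    rw [← Finset.sum_smul]
    simp only [mul_comm]
  rw [positionT, ← Finset.sum_add_distrib]
  simp only [key]
  rw [Finset.sum_sub_distrib, Finset.sum_add_distrib, ← Finset.smul_sum, hcancel,
    ← Finset.smul_sum, ← Finset.sum_smul, Finset.sum_sub_distrib, ← Finset.smul_sum, rT_eq, qSum,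
    pSum]
  have e3 : K * bCoeff μ * μ * ζ x ^ 2 / Del ξ x
      = bCoeff μ / Del ξ x * ζ x * (μ * (K * ζ x)) := by ring
  rw [e3]
  module

end Position

/-! ### Restriction to the open set where the coefficients do not vanish -/

section Restriction

variable {n : ℕ} {K : ℝ} {U W : Set (Coord n)} {ρ : Fin n → Coord n → ℝ}
  {γ : Fin n → Fin n → Coord n → ℝ}

theorem GaussCodazzi.mono (h : GaussCodazzi K U ρ γ) (hW : W ⊆ U) : GaussCodazzi K W ρ γ :=
  ⟨fun i => (h.smooth_rho i).mono hW, fun i j => (h.smooth_gamma i j).mono hW,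
    fun x hx => h.diag x (hW hx), fun x hx => h.eq₁ x (hW hx), fun x hx => h.eq₂ x (hW hx),
    fun x hx => h.eq₃ x (hW hx), fun x hx => h.eq₄ x (hW hx)⟩

theorem OmegaSystem.mono {ω : Coord n → Matrix (Fin n) (Fin n) ℝ} (h : OmegaSystem U γ ω)
    (hW : W ⊆ U) : OmegaSystem W γ ω :=
  ⟨fun i α => (h.smooth i α).mono hW, fun x hx => h.orthogonal x (hW hx),
    fun x hx => h.offdiag x (hW hx), fun x hx => h.diag x (hW hx)⟩

theorem IsMovingFrame.mono {p q : Fin n → Coord n → Ambient n} {r : Coord n → Ambient n}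
    (h : IsMovingFrame K U ρ γ p q r) (hW : W ⊆ U) : IsMovingFrame K W ρ γ p q r :=
  .of_isAdaptedFrame
    ⟨fun i => (h.structure_eq.smooth_u i).mono hW, fun i => (h.structure_eq.smooth_v i).mono hW,
      h.structure_eq.smooth_w.mono hW, fun x hx => h.structure_eq.u_diag x (hW hx),
      fun x hx => h.structure_eq.u_offdiag x (hW hx), fun x hx => h.structure_eq.v_diag x (hW hx),
      fun x hx => h.structure_eq.v_offdiag x (hW hx), fun x hx => h.structure_eq.w_eq x (hW hx)⟩
    fun _ hx => h.isAdaptedFrame (hW hx)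

theorem isOpen_setOf_forall_ne_zero (hU : IsOpen U) (h : ∀ i, SmoothOn U (ρ i)) :
    IsOpen {x ∈ U | ∀ i, ρ i x ≠ 0} := by
  rw [isOpen_iff_mem_nhds]
  rintro x ⟨hx, h0⟩
  refine Filter.Eventually.and (hU.mem_nhds hx) (Filter.eventually_all.2 fun i => ?_)
  exact ((h i).contDiffAt (hU.mem_nhds hx)).continuousAt.eventually_ne (h0 i)

end Restriction

/-! ### Constant curvature of the diagonal metric -/

section Curvature

variable {n : ℕ} {K : ℝ} {U : Set (Coord n)} {ρ : Fin n → Coord n → ℝ}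
  {γ : Fin n → Fin n → Coord n → ℝ} {g : Coord n → Matrix (Fin n) (Fin n) ℝ} {x : Coord n}

/-- This is the rule ∇_i q_k = δ_ik Σ γ_il q_l - γ_ik q_i for the unit vectors, rewritten for ∂_k =
ρ_k q_k. The indicators avoid case distinctions in the curvature. -/
theorem christoffel_of_diagonal (hU : IsOpen U) (hG : GaussCodazzi K U ρ γ)
    (hg : ∀ x ∈ U, ∀ i j, g x i j = if i = j then ρ i x ^ 2 else 0)
    (hρ : ∀ x ∈ U, ∀ i, ρ i x ≠ 0) (hx : x ∈ U) (l i k : Fin n) :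
    christoffel g l i k x = (ρ l x)⁻¹ * ((if l = k then 1 else 0) * pd i (ρ k) x
      + ρ k x * ((if i = k then 1 else 0) * γ i l x - (if i = l then 1 else 0) * γ i k x)) := by
  have hinv : (g x)⁻¹ = Matrix.diagonal fun i => (ρ i x ^ 2)⁻¹ := by
    have : g x = Matrix.diagonal fun i => ρ i x ^ 2 := by
      ext i j
      rw [hg x hx, Matrix.diagonal_apply]
    rw [this]
    refine Matrix.inv_eq_left_inv ?_
    rw [Matrix.diagonal_mul_diagonal, ← Matrix.diagonal_one]
    congr 1
    funext i
    exact inv_mul_cancel₀ (pow_ne_zero 2 (hρ x hx i))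
  have hpd : ∀ a b c, pd a (fun y => g y b c) x =
      if b = c then 2 * ρ b x * pd a (ρ b) x else 0 := by
    intro a b c
    have hb := SmoothOn.hasPd (hG.smooth_rho b) hU hx a
    refine (((hb.mul hb).mul (HasPd.const a (if b = c then 1 else 0) x)).congr_on hU hx
      fun y hy => ?_).eq.trans ?_
    · rw [hg y hy]; split_ifs <;> ring
    · split_ifs <;> ring
  have hoff : ∀ a b, a ≠ b → pd b (ρ a) x = -(γ a b x * ρ b x) := fun a b h =>
    eq_neg_of_add_eq_zero_left (hG.eq₄ x hx a b h)
  have hd := hG.diag x hx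
  have h0 := hρ x hx
  rw [christoffel, hinv]
  simp only [Matrix.diagonal_apply, ite_mul, zero_mul, Finset.sum_ite_eq, Finset.mem_univ, if_true,
    hpd]
  by_cases hik : i = k
  · subst hik
    by_cases hil : i = l
    · subst hil
      have := h0 i
      simp [hd]
      field_simp
    · have := h0 i
      have := h0 l
      simp [hil, Ne.symm hil, hoff i l hil]
      field_simp
  · by_cases hil : i = l
    · subst hil
      have := h0 i
      simp [hik, Ne.symm hik, hoff i k hik]
      field_simp
    · by_cases hkl : k = l
      · subst hkl
        have := h0 k
        simp [hik]
        field_simp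
      · simp [hik, hil, hkl, Ne.symm hkl]

/-- Rescaling to unit vectors, the derivatives of ρ drop out and the curvature is ρ_k/ρ_l times that
of the skew connection. Its components vanish by `eq₂`, except those in the plane of i and j, which
`eq₃` evaluates. -/
theorem hasConstantCurvature_of_diagonal (hU : IsOpen U) (hG : GaussCodazzi K U ρ γ)
    (hg : ∀ x ∈ U, ∀ i j, g x i j = if i = j then ρ i x ^ 2 else 0)
    (hρ : ∀ x ∈ U, ∀ i, ρ i x ≠ 0) : HasConstantCurvature K U g := by
  intro x hx l k i j
  have hΓ := fun y hy => christoffel_of_diagonal (x := y) hU hG hg hρ hy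
  have h0 := hρ x hx
  have hd : ∀ l i k j : Fin n, pd j (christoffel g l i k) x =
      -pd j (ρ l) x / ρ l x ^ 2 * ((if l = k then 1 else 0) * pd i (ρ k) x
        + ρ k x * ((if i = k then 1 else 0) * γ i l x - (if i = l then 1 else 0) * γ i k x))
      + (ρ l x)⁻¹ * ((if l = k then 1 else 0) * pd j (pd i (ρ k)) x
        + (pd j (ρ k) x * ((if i = k then 1 else 0) * γ i l x - (if i = l then 1 else 0) * γ i k x)
        + ρ k x * ((if i = k then 1 else 0) * pd j (γ i l) x
          - (if i = l then 1 else 0) * pd j (γ i k) x))) := by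
    intro l i k j
    have hr := fun k => SmoothOn.hasPd (hG.smooth_rho k) hU hx j
    have hγ := fun k => SmoothOn.hasPd (hG.smooth_gamma i k) hU hx j
    have hrr := SmoothOn.hasPd (SmoothOn.pd (hG.smooth_rho k) hU i) hU hx j
    refine ((((hr l).inv (h0 l)).mul (((HasPd.const j (if l = k then 1 else 0) x).mul hrr).add
      ((hr k).mul (((HasPd.const j (if i = k then 1 else 0) x).mul (hγ l)).sub
        ((HasPd.const j (if i = l then 1 else 0) x).mul (hγ k)))))).congr_on hU hx
      fun y hy => hΓ y hy l i k).eq.trans ?_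
    ring
  have hsum : ∀ i j, ∑ m, christoffel g l i m x * christoffel g m j k x
      = (ρ l x)⁻¹ * ((ρ l x)⁻¹ * pd i (ρ l) x * ((if l = k then 1 else 0) * pd j (ρ k) x
          + ρ k x * ((if j = k then 1 else 0) * γ j l x - (if j = l then 1 else 0) * γ j k x))
        + ((if i = k then 1 else 0) * γ i l x - (if i = l then 1 else 0) * γ i k x) * pd j (ρ k) x
        + ρ k x * ((if j = k then 1 else 0) * γ i l x * γ j i x
          - (if i = j then 1 else 0) * γ i l x * γ j k x
          - (if i = l then 1 else 0) * (if j = k then 1 else 0) * ∑ m, γ i m x * γ j m x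
          + (if i = l then 1 else 0) * γ i j x * γ j k x)) := by
    intro i j
    have e : ∀ m, christoffel g l i m x * christoffel g m j k x
        = (ρ l x)⁻¹ * ((if l = m then (ρ l x)⁻¹ * pd i (ρ l) x *
              ((if l = k then 1 else 0) * pd j (ρ k) x
          + ρ k x * ((if j = k then 1 else 0) * γ j l x - (if j = l then 1 else 0) * γ j k x))
          else 0)
        + (if m = k then ((if i = k then 1 else 0) * γ i l x - (if i = l then 1 else 0) * γ i k x)
          * pd j (ρ k) x else 0)
        + ρ k x * ((if i = m then (if j = k then 1 else 0) * γ i l x * γ j i x else 0)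
          - (if j = m then (if i = j then 1 else 0) * γ i l x * γ j k x else 0)
          - (if i = l then 1 else 0) * (if j = k then 1 else 0) * (γ i m x * γ j m x)
          + (if j = m then (if i = l then 1 else 0) * γ i j x * γ j k x else 0))) := by
      intro m
      rw [hΓ x hx, hΓ x hx]
      have e2 : (if l = m then (1 : ℝ) else 0) * ((ρ m x)⁻¹ * (pd i (ρ m) x *
          ((if m = k then 1 else 0) * pd j (ρ k) x + ρ k x *
            ((if j = k then 1 else 0) * γ j m x - (if j = m then 1 else 0) * γ j k x))))
          = if l = m then (ρ l x)⁻¹ * pd i (ρ l) x *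
              ((if l = k then 1 else 0) * pd j (ρ k) x
          + ρ k x * ((if j = k then 1 else 0) * γ j l x - (if j = l then 1 else 0) * γ j k x))
            else 0 := by
        split_ifs <;> simp_all [mul_assoc]
      have e3 : ((if i = m then (1 : ℝ) else 0) * γ i l x - (if i = l then 1 else 0) * γ i m x) *
          ((if m = k then 1 else 0) * pd j (ρ k) x) =
          (if m = k then ((if i = k then 1 else 0) * γ i l x - (if i = l then 1 else 0) * γ i k x)
          * pd j (ρ k) x else 0) := by
        by_cases h : m = k <;> simp [h]
      have e4 : ((if i = m then (1 : ℝ) else 0) * γ i l x - (if i = l then 1 else 0) * γ i m x) *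
          ((if j = k then 1 else 0) * γ j m x - (if j = m then 1 else 0) * γ j k x) =
          ((if i = m then (if j = k then 1 else 0) * γ i l x * γ j i x else 0)
          - (if j = m then (if i = j then 1 else 0) * γ i l x * γ j k x else 0)
          - (if i = l then 1 else 0) * (if j = k then 1 else 0) * (γ i m x * γ j m x)
          + (if j = m then (if i = l then 1 else 0) * γ i j x * γ j k x else 0)) := by
        by_cases h : i = m
        · subst h
          by_cases h' : j = i
          · subst h'; simp only [if_true]; split_ifs <;> ring
          · simp only [if_true, if_neg h']; split_ifs <;> ring
        · by_cases h' : j = m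
          · subst h'; simp only [if_true, if_neg h]; split_ifs <;> ring
          · simp only [if_neg h, if_neg h']; split_ifs <;> ring
      rw [← e2, ← e3, ← e4]
      have := h0 m
      field_simp
      ring
    simp only [e, ← Finset.mul_sum, Finset.sum_add_distrib, Finset.sum_sub_distrib,
      Finset.sum_ite_eq, Finset.sum_ite_eq', Finset.mem_univ, if_true]
  rw [riemann, hd, hd, Finset.sum_sub_distrib, hsum, hsum, hg x hx, hg x hx,
    SmoothOn.pd_comm (hG.smooth_rho k) hU hx i j]
  by_cases hij : i = j
  · subst hij; ring
  -- For l different from i and j this is `eq₂`; the indicators record the two degenerate cases.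
  have E : ∀ i j l : Fin n, i ≠ j → pd i (γ j l) x + γ j i x * γ i l x
      = (if i = l then 1 else 0) * pd i (γ j i) x
        + (if j = l then 1 else 0) * (γ j i x * γ i j x) := by
    intro i j l hij
    by_cases hil : i = l
    · subst hil
      simp [hG.diag x hx, Ne.symm hij]
    · by_cases hjl : j = l
      · subst hjl
        have : pd i (γ j j) x = 0 :=
          ((HasPd.const i (0 : ℝ) x).congr_on hU hx fun y hy => hG.diag y hy j).eq
        simp [this, hij]
      · have := hG.eq₂ x hx j l i hjl (Ne.symm hij) (Ne.symm hil)
        simp [this, hil, hjl]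
  have h3 := hG.eq₃ x hx i j hij
  rw [sum_erase_erase hij, hG.diag x hx, hG.diag x hx] at h3
  have hcomm : ∑ m, γ j m x * γ i m x = ∑ m, γ i m x * γ j m x := by simp only [mul_comm]
  rw [hcomm, if_neg hij, if_neg (Ne.symm hij)]
  have c1 : (if l = i then (1 : ℝ) else 0) = if i = l then 1 else 0 := by simp only [eq_comm]
  have c2 : (if l = j then (1 : ℝ) else 0) = if j = l then 1 else 0 := by simp only [eq_comm]
  -- On the support of the indicators the metric coefficient acquires the factor ρ_k/ρ_l of the
  -- curvature side.
  have g1 : (if j = k then ρ j x ^ 2 else 0) * (if i = l then (1 : ℝ) else 0) =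
      (if j = k then 1 else 0) * (if i = l then 1 else 0) *
        ((ρ l x)⁻¹ * ρ k x * (ρ i x * ρ j x)) := by
    by_cases a : j = k
    · by_cases b : i = l
      · subst a b; have := h0 i; simp; field_simp
      · simp [b]
    · simp [a]
  have g2 : (if i = k then ρ i x ^ 2 else 0) * (if j = l then (1 : ℝ) else 0) =
      (if i = k then 1 else 0) * (if j = l then 1 else 0) *
        ((ρ l x)⁻¹ * ρ k x * (ρ i x * ρ j x)) := by
    by_cases a : i = k
    · by_cases b : j = l
      · subst a b; have := h0 j; simp; field_simp
      · simp [b]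
    · simp [a]
  rw [c1, c2, g1, g2]
  have i2 : ∀ a, -pd a (ρ l) x / ρ l x ^ 2 = -((ρ l x)⁻¹ * ((ρ l x)⁻¹ * pd a (ρ l) x)) := by
    intro a; have := h0 l; field_simp
  rw [i2, i2]
  have E1 := E i j l hij
  have E2 := E i j k hij
  have E3 := E j i l (Ne.symm hij)
  have E4 := E j i k (Ne.symm hij)
  generalize (if i = k then (1 : ℝ) else 0) = δik at *
  generalize (if j = k then (1 : ℝ) else 0) = δjk at *
  generalize (if i = l then (1 : ℝ) else 0) = δil at *
  generalize (if j = l then (1 : ℝ) else 0) = δjl at *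
  generalize (ρ l x)⁻¹ = s at *
  linear_combination s * ρ k x * (δjk * E1 - δjl * E2 - δik * E3 + δil * E4
    + (δil * δjk - δjl * δik) * h3)

end Curvature

/-! ### The immersion determined by a frame -/

section Immersion

variable {n : ℕ} {K : ℝ} {U : Set (Coord n)} {ρ : Fin n → Coord n → ℝ}
  {γ : Fin n → Fin n → Coord n → ℝ} {ω : Coord n → Matrix (Fin n) (Fin n) ℝ}
  {p q : Fin n → Coord n → Ambient n} {r : Coord n → Ambient n} {x : Coord n}

theorem sum_mul_of_mem_orthogonalGroup {A : Matrix (Fin n) (Fin n) ℝ}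
    (h : A ∈ Matrix.orthogonalGroup (Fin n) ℝ) (α β : Fin n) :
    ∑ i, A i α * A i β = if α = β then 1 else 0 := by
  have := congrFun (congrFun ((Matrix.mem_orthogonalGroup_iff' (Fin n) ℝ).1 h) α) β
  simpa [Matrix.mul_apply, Matrix.one_apply] using this

theorem sum_mul_of_mem_orthogonalGroup' {A : Matrix (Fin n) (Fin n) ℝ}
    (h : A ∈ Matrix.orthogonalGroup (Fin n) ℝ) (i j : Fin n) :
    ∑ α, A i α * A j α = if i = j then 1 else 0 := by
  have := congrFun (congrFun ((Matrix.mem_orthogonalGroup_iff (Fin n) ℝ).1 h) i) j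
  simpa [Matrix.mul_apply, Matrix.one_apply] using this

namespace IsMovingFrame

/-- Since ∂_i r = ρ_i q_i with ρ_i ≠ 0, orthogonality to the immersion is orthogonality to q. -/
theorem mem_normalSpace_iff (hF : IsMovingFrame K U ρ γ p q r) (hρ : ∀ x ∈ U, ∀ i, ρ i x ≠ 0)
    (hx : x ∈ U) {ν : Ambient n} : ν ∈ normalSpace K r x ↔
      ν ∈ spaceFormTangent K (r x) ∧ ∀ i, ambientForm K (q i x) ν = 0 := by
  refine and_congr_right fun _ => forall_congr' fun i => ?_
  rw [hF.structure_eq.w_eq x hx, ← ambientForm_apply, map_smul, smul_eq_mul,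
    mul_eq_zero_iff_left (hρ x hx i), ambientForm_comm]

theorem p_mem_normalSpace (hF : IsMovingFrame K U ρ γ p q r) (hρ : ∀ x ∈ U, ∀ i, ρ i x ≠ 0)
    (hx : x ∈ U) (i : Fin n) : p i x ∈ normalSpace K r x :=
  (hF.mem_normalSpace_iff hρ hx).2
    ⟨hF.p_tangent x hx i, fun j => (hF.isAdaptedFrame hx).inner_qp j i⟩

theorem normalOf_mem_normalSpace (hF : IsMovingFrame K U ρ γ p q r)
    (hρ : ∀ x ∈ U, ∀ i, ρ i x ≠ 0) (hx : x ∈ U) (α : Fin n) :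
    normalOf ω p α x ∈ normalSpace K r x := by
  refine (hF.mem_normalSpace_iff hρ hx).2 ⟨?_, fun j => ?_⟩
  · exact (tangentSubmodule K (r x)).sum_mem fun i _ =>
      (tangentSubmodule K (r x)).smul_mem _ (hF.p_tangent x hx i)
  · simp [normalOf, (hF.isAdaptedFrame hx).inner_qp]

theorem ambientForm_p_normalOf (hF : IsMovingFrame K U ρ γ p q r) (hx : x ∈ U) (i α : Fin n) :
    ambientForm K (p i x) (normalOf ω p α x) = ω x i α := by
  simp [normalOf, (hF.isAdaptedFrame hx).inner_pp]

/-- The second fundamental form. -/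
theorem inner_pd_pd (hU : IsOpen U) (hG : GaussCodazzi K U ρ γ) (hF : IsMovingFrame K U ρ γ p q r)
    (hρ : ∀ x ∈ U, ∀ i, ρ i x ≠ 0) (hx : x ∈ U) (i j : Fin n) {ν : Ambient n}
    (hν : ν ∈ normalSpace K r x) :
    ambientForm K (pd i (pd j r) x) ν = if i = j then ρ i x * ambientForm K (p i x) ν else 0 := by
  have hν' := (hF.mem_normalSpace_iff hρ hx).1 hν
  have hr := mul_ambientForm_of_tangent hν'.1
  rw [(hasPd_pd_position hG hF.structure_eq hU hx i j).eq]
  by_cases h : i = j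
  · subst h
    simp only [if_true, map_add, map_sub, map_neg, map_sum, map_smul, LinearMap.add_apply,
      LinearMap.sub_apply, LinearMap.neg_apply, LinearMap.sum_apply, LinearMap.smul_apply,
      hν'.2, smul_eq_mul, mul_zero, Finset.sum_const_zero]
    linear_combination -ρ i x ^ 2 * hr
  · simp [h, Ne.symm h, hν'.2]

theorem inducedMetric_eq (hF : IsMovingFrame K U ρ γ p q r) (hx : x ∈ U) (i j : Fin n) :
    inducedMetric K r x i j = if i = j then ρ i x ^ 2 else 0 := by
  rw [inducedMetric, Matrix.of_apply, hF.structure_eq.w_eq x hx, hF.structure_eq.w_eq x hx,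
    ← ambientForm_apply, map_smul, map_smul, LinearMap.smul_apply, ambientForm_apply,
    hF.inner_qq x hx]
  by_cases h : i = j
  · subst h; simp [sq]
  · simp [h]

theorem isParallelNormalFrame (hU : IsOpen U) (hG : GaussCodazzi K U ρ γ)
    (hF : IsMovingFrame K U ρ γ p q r) (hω : OmegaSystem U γ ω) (hρ : ∀ x ∈ U, ∀ i, ρ i x ≠ 0) :
    IsParallelNormalFrame K U r (normalOf ω p) where
  smooth α := ContDiffOn.sum fun i _ => (hω.smooth i α).smul (hF.structure_eq.smooth_u i)
  normal x hx α := hF.normalOf_mem_normalSpace hρ hx α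
  orthonormal x hx α β := by
    rw [← ambientForm_apply, ← sum_mul_of_mem_orthogonalGroup (hω.orthogonal x hx)]
    conv_lhs => rw [normalOf]
    simp [hF.ambientForm_p_normalOf hx]
  parallel x hx α i ν hν := by
    -- The columns of ω and the p_i obey the same skew connection, so the derivative of their
    -- pairing is the tangential vector -ω_iα q_i.
    have h := ((hω.hasRotPd hG.diag hU hx i α).sum_smul
      (hF.structure_eq.hasRotPd_u hG.diag hU hx i)).eq
    change pd i (normalOf ω p α) x = _ at h
    rw [← ambientForm_apply, h]
    simp [((hF.mem_normalSpace_iff hρ hx).1 hν).2]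

theorem hasPrincipalForms (hU : IsOpen U) (hG : GaussCodazzi K U ρ γ)
    (hF : IsMovingFrame K U ρ γ p q r) (hω : OmegaSystem U γ ω) (hρ : ∀ x ∈ U, ∀ i, ρ i x ≠ 0) :
    HasPrincipalForms K U r ρ ω (normalOf ω p) where
  smooth := hF.structure_eq.smooth_w
  smooth_rho := hG.smooth_rho
  smooth_omega := hω.smooth
  mem := hF.mem
  rho_ne_zero := hρ
  orthogonal := hω.orthogonal
  frame := hF.isParallelNormalFrame hU hG hω hρ
  first x hx := hF.inducedMetric_eq hx
  second x hx i j α := by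
    rw [← ambientForm_apply,
      hF.inner_pd_pd hU hG hρ hx i j (hF.normalOf_mem_normalSpace hρ hx α),
      hF.ambientForm_p_normalOf hx]

/-- Both fundamental forms are diagonal. Testing with Y = ∂_j for an index with X_j ≠ 0 gives ρ_j
p_j = ρ_j² h on the normal space. -/
theorem eq_of_isCurvatureNormal (hU : IsOpen U) (hG : GaussCodazzi K U ρ γ)
    (hF : IsMovingFrame K U ρ γ p q r) (hρ : ∀ x ∈ U, ∀ i, ρ i x ≠ 0) (hx : x ∈ U)
    {h : Ambient n} (hh : IsCurvatureNormal K r x h) : ∃ j, (ρ j x)⁻¹ • p j x = h := by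
  obtain ⟨hN, X, hX, hII⟩ := hh
  obtain ⟨j, hj⟩ := Function.ne_iff.1 hX
  have hj : X j ≠ 0 := hj
  refine ⟨j, ?_⟩
  have hν : ∀ ν ∈ normalSpace K r x, ambientForm K ν ((ρ j x)⁻¹ • p j x - h) = 0 := by
    intro ν hν
    have := hII (Pi.single j 1) ν hν
    simp only [← ambientForm_apply, hF.inner_pd_pd hU hG hρ hx _ _ hν, hF.inducedMetric_eq hx,
      Pi.single_apply, mul_ite, ite_mul, mul_zero, mul_one, zero_mul, Finset.sum_ite_eq,
      Finset.sum_ite_eq', Finset.mem_univ, if_true] at this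
    have h0 := hρ x hx j
    rw [map_sub, map_smul, ambientForm_comm, ambientForm_comm K ν, smul_eq_mul]
    have h1 : X j * (ρ j x * ρ j x) *
        ((ρ j x)⁻¹ * ambientForm K (p j x) ν - ambientForm K h ν) = 0 := by
      field_simp
      linear_combination this
    exact (mul_eq_zero.1 h1).resolve_left (mul_ne_zero hj (mul_ne_zero h0 h0))
  have hN' := (hF.mem_normalSpace_iff hρ hx).1 hN
  have hp := hF.p_mem_normalSpace hρ hx
  have hp' := (hF.mem_normalSpace_iff hρ hx).1 (hp j)
  refine sub_eq_zero.1 ((hF.isAdaptedFrame hx).eq_zero ?_ (fun i => hν _ (hp i)) fun i => ?_)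
  · exact (tangentSubmodule K (r x)).sub_mem
      ((tangentSubmodule K (r x)).smul_mem _ (hF.p_tangent x hx j)) hN'.1
  · rw [map_sub, map_smul, hp'.2, hN'.2, smul_zero, sub_zero]

theorem isSpaceFormImmersion (hU : IsOpen U) (hG : GaussCodazzi K U ρ γ)
    (hF : IsMovingFrame K U ρ γ p q r) (hω : OmegaSystem U γ ω) (hρ : ∀ x ∈ U, ∀ i, ρ i x ≠ 0) :
    IsSpaceFormImmersion K U r where
  smooth := hF.structure_eq.smooth_w
  mem := hF.mem
  immersion x hx := linearIndependent_of_orthogonal (ambientForm K)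
    (fun i j => hF.inducedMetric_eq hx i j) fun i => pow_ne_zero 2 (hρ x hx i)
  curvature := hasConstantCurvature_of_diagonal hU hG (fun _ hx => hF.inducedMetric_eq hx) hρ
  flat x hx := ⟨U, hU, hx, subset_rfl, _, hF.isParallelNormalFrame hU hG hω hρ⟩
  curvatureNormals x hx := by
    have hli : LinearIndependent ℝ fun j => (ρ j x)⁻¹ • p j x := by
      refine linearIndependent_of_orthogonal (ambientForm K) (ε := fun j => (ρ j x)⁻¹ ^ 2)
        (fun i j => ?_) fun j => pow_ne_zero 2 (inv_ne_zero (hρ x hx j))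
      rw [map_smul, map_smul, LinearMap.smul_apply, (hF.isAdaptedFrame hx).inner_pp]
      by_cases h : i = j
      · subst h; simp [sq]
      · simp [h]
    -- The curvature normals lie among n orthogonal nonzero vectors; this inclusion suffices.
    exact hli.linearIndepOn_id.mono fun h hh => hF.eq_of_isCurvatureNormal hU hG hρ hx hh

end IsMovingFrame

end Immersion

/-! ### The Gauss-Codazzi equations as compatibility conditions -/

section Compatibility

variable {n : ℕ} {K : ℝ} {U : Set (Coord n)} {ρ : Fin n → Coord n → ℝ}
  {γ : Fin n → Fin n → Coord n → ℝ} {p q : Fin n → Coord n → Ambient n}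
  {r : Coord n → Ambient n}

/-- The Gauss-Codazzi equations are the compatibility conditions of the structure equations. -/
theorem IsMovingFrame.gaussCodazzi (hU : IsOpen U) (hF : IsMovingFrame K U ρ γ p q r)
    (sρ : ∀ i, SmoothOn U (ρ i)) (sγ : ∀ i j, SmoothOn U (γ i j))
    (hγ : ∀ x ∈ U, ∀ i, γ i i x = 0)
    (h4 : ∀ x ∈ U, ∀ i j, i ≠ j → pd j (ρ i) x + γ i j x * ρ j x = 0) :
    GaussCodazzi K U ρ γ where
  smooth_rho := sρ
  smooth_gamma := sγ
  diag := hγ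
  eq₄ := h4
  eq₁ x hx i j hij := by
    have hA := hF.isAdaptedFrame hx
    have hL := hF.structure_eq
    have dγ := fun a b c => SmoothOn.hasPd (sγ a b) hU hx c
    have hp := fun k => hL.hasRotPd_u hγ hU hx k
    have h1 : HasPd i (pd j (p i)) _ x := (((dγ i j i).smul ((hp i).offdiag hij.symm)).neg).congr_on
      hU hx fun y hy => ((hL.hasRotPd_u hγ hU hy j).offdiag hij).eq
    have h2 : HasPd j (pd i (p i)) _ x := ((HasPd.sum fun k _ => (dγ k i j).smul (hp j k)).add
      (((hL.hasRotPd_v hγ hU hx j).offdiag hij).neg)).congr_on hU hx fun y hy => by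
        rw [((hL.hasRotPd_u hγ hU hy i).diag (hγ y hy i)).eq, one_smul]
    -- The p_j component of ∂_i∂_j p_i = ∂_j∂_i p_i.
    have h3 := congrArg (ambientForm K (p j x)) (h1.eq.symm.trans
      ((SmoothOn.pd_comm (hL.smooth_u i) hU hx i j).trans h2.eq))
    have e : ∀ k, ambientForm K (p j x) (if k = j then (∑ l, γ l j x • p l x)
        + -((1 : ℝ) • q j x) else 0) = 0 := by
      intro k
      split_ifs <;> simp [hA.inner_pp, hA.inner_pq, hγ x hx]
    simp only [map_neg, map_add, map_sum, map_smul, smul_eq_mul, hA.inner_pp, hA.inner_pq, e,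
      if_true, if_false, mul_neg, mul_one, mul_ite, mul_zero, neg_zero, add_zero,
      Finset.sum_add_distrib, Finset.sum_ite_eq, Finset.mem_erase, Finset.mem_univ, ne_eq, hij.symm,
      not_false_eq_true, and_self, Finset.sum_neg_distrib] at h3
    rw [sum_erase_eq_left hij, hγ x hx j] at h3
    linear_combination -h3
  eq₂ x hx i j k hij hik hjk := by
    have hA := hF.isAdaptedFrame hx
    have hL := hF.structure_eq
    have dγ := fun a b c => SmoothOn.hasPd (sγ a b) hU hx c
    have hp := fun k => hL.hasRotPd_u hγ hU hx k
    have h1 : HasPd k (pd j (p i)) _ x := (((dγ i j k).smul ((hp k).offdiag hjk)).neg).congr_on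
      hU hx fun y hy => ((hL.hasRotPd_u hγ hU hy j).offdiag hij).eq
    have h2 : HasPd j (pd k (p i)) _ x := (((dγ i k j).smul ((hp j).offdiag hjk.symm)).neg).congr_on
      hU hx fun y hy => ((hL.hasRotPd_u hγ hU hy k).offdiag hik).eq
    have h3 := congrArg (ambientForm K (p j x)) (h1.eq.symm.trans
      ((SmoothOn.pd_comm (hL.smooth_u i) hU hx k j).trans h2.eq))
    simp [hA.inner_pp, hjk] at h3
    linear_combination -h3
  eq₃ x hx i j hij := by
    have hA := hF.isAdaptedFrame hx
    have hL := hF.structure_eq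
    have dγ := fun a b c => SmoothOn.hasPd (sγ a b) hU hx c
    have hq := fun k => hL.hasRotPd_v hγ hU hx k
    have hr := mul_ambientForm_of_tangent (hA.q_tangent j)
    rw [ambientForm_comm] at hr
    have h1 : HasPd i (pd j (q i)) _ x := (((dγ j i i).smul ((hq i).offdiag hij.symm)).neg).congr_on
      hU hx fun y hy => ((hL.hasRotPd_v hγ hU hy j).offdiag hij).eq
    have h2 : HasPd j (pd i (q i)) _ x := ((HasPd.sum fun k _ => (dγ i k j).smul (hq j k)).add
      (((hL.hasRotPd_u hγ hU hx j).offdiag hij).sub (((HasPd.const j K x).mul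
        (SmoothOn.hasPd (sρ i) hU hx j)).smul (hL.hasPd_w hU hx j)))).congr_on hU hx
        fun y hy => by
          rw [((hL.hasRotPd_v hγ hU hy i).diag (hγ y hy i)).eq, one_smul]
    -- The q_j component of ∂_i∂_j q_i = ∂_j∂_i q_i; the term -Kρ_i r in ∂_i q_i yields Kρ_iρ_j.
    have h3 := congrArg (ambientForm K (q j x)) (h1.eq.symm.trans
      ((SmoothOn.pd_comm (hL.smooth_v i) hU hx i j).trans h2.eq))
    have e : ∀ k, ambientForm K (q j x) (if k = j then (∑ l, γ j l x • q l x)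
        + ((1 : ℝ) • p j x - (K * ρ j x) • r x) else 0) = 0 := by
      intro k
      split_ifs
      · simp only [map_add, map_sub, map_sum, map_smul, smul_eq_mul, hA.inner_qq, hA.inner_qp,
          mul_ite, mul_one, mul_zero, Finset.sum_ite_eq, Finset.mem_univ, if_true, hγ x hx]
        linear_combination -ρ j x * hr
      · exact map_zero _
    simp only [map_neg, map_add, map_sub, map_sum, map_smul, smul_eq_mul, hA.inner_qq, hA.inner_qp,
      e, if_true, if_false, mul_neg, mul_one, mul_ite, mul_zero, zero_mul, neg_zero,
      zero_add, add_zero, Finset.sum_add_distrib, Finset.sum_ite_eq, Finset.mem_erase,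
      Finset.mem_univ, ne_eq, hij.symm, not_false_eq_true, and_self, Finset.sum_neg_distrib] at h3
    rw [sum_erase_eq_left hij, hγ x hx j] at h3
    linear_combination -h3 + pd j (ρ i) x * hr

end Compatibility

/-! ### From an immersion in principal coordinates to its frame -/

section Principal

variable {n : ℕ} {K : ℝ} {U : Set (Coord n)} {V : Coord n → Ambient n}
  {ρ : Fin n → Coord n → ℝ} {ω : Coord n → Matrix (Fin n) (Fin n) ℝ}
  {e : Fin n → Coord n → Ambient n} {x : Coord n}

/-- Differentiating ⟨V, f⟩ = 0 gives ⟨V, f'⟩ = -⟨V', f⟩ for K ≠ 0. As ⟨V, V⟩ = K and K² = 1, the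
added multiple of V cancels this; for K = 0 it vanishes. -/
theorem pd_mem_tangent (hK : K * K * K = K) (hU : IsOpen U) (hx : x ∈ U)
    {f : Coord n → Ambient n} {f' V' : Ambient n} {j : Fin n}
    (hV : HasPd j V V' x) (hVm : ∀ y ∈ U, V y ∈ spaceForm n K) (hf : HasPd j f f' x)
    (hft : ∀ y ∈ U, f y ∈ spaceFormTangent K (V y)) :
    f' + (K * ambientForm K V' (f x)) • V x ∈ spaceFormTangent K (V x) := by
  refine ⟨fun h0 => ?_, fun h0 => ?_⟩
  · have : f' (Fin.last (2 * n)) = 0 := (hf.coord (Fin.last (2 * n))).unique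
      ((HasPd.const j (0 : ℝ) x).congr_on hU hx fun y hy => (hft y hy).1 h0)
    simp [this, h0]
  · have h1 := (hV.inner (K := K) hf).unique
      ((HasPd.const j (0 : ℝ) x).congr_on hU hx fun y hy => (hft y hy).2 h0)
    have h2 : ambientForm K (V x) (V x) = K := (hVm x hx).2 h0
    have h3 : K * K = 1 := mul_right_cancel₀ h0 (by rw [hK, one_mul])
    rw [← ambientForm_apply, map_add, map_smul, h2, smul_eq_mul]
    linear_combination h1 + ambientForm K V' (f x) * h3

theorem pd_position_mem_tangent (hU : IsOpen U) (hx : x ∈ U) {V' : Ambient n} {j : Fin n}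
    (hV : HasPd j V V' x) (hVm : ∀ y ∈ U, V y ∈ spaceForm n K) :
    V' ∈ spaceFormTangent K (V x) := by
  refine ⟨fun h0 => ?_, fun h0 => ?_⟩
  · exact (hV.coord (Fin.last (2 * n))).unique
      ((HasPd.const j (0 : ℝ) x).congr_on hU hx fun y hy => (hVm y hy).1 h0)
  · have h1 := (hV.inner (K := K) hV).unique
      ((HasPd.const j K x).congr_on hU hx fun y hy => (hVm y hy).2 h0)
    rw [ambientForm_comm K V'] at h1
    rw [← ambientForm_apply]
    linarith

namespace HasPrincipalForms

theorem pd_eq (h : HasPrincipalForms K U V ρ ω e) (hx : x ∈ U) (i : Fin n) :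
    pd i V x = ρ i x • qOf ρ V i x := by
  rw [qOf, smul_smul, mul_inv_cancel₀ (h.rho_ne_zero x hx i), one_smul]

theorem isAdaptedFrame (h : HasPrincipalForms K U V ρ ω e) (hU : IsOpen U) (hx : x ∈ U) :
    IsAdaptedFrame K (fun i => pOf ω e i x) (fun i => qOf ρ V i x) (V x) where
  mem := h.mem x hx
  p_tangent i := (tangentSubmodule K (V x)).sum_mem fun α _ =>
    (tangentSubmodule K (V x)).smul_mem _ (h.frame.normal x hx α).1
  q_tangent i := (tangentSubmodule K (V x)).smul_mem _
    (pd_position_mem_tangent hU hx (SmoothOn.hasPd h.smooth hU hx i) h.mem)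
  inner_pp i j := by
    rw [← sum_mul_of_mem_orthogonalGroup' (h.orthogonal x hx)]
    simp [pOf, ambientForm_apply, h.frame.orthonormal x hx, mul_comm]
  inner_qq i j := by
    have h1 : ambientForm K (pd i V x) (pd j V x) = _ := h.first x hx i j
    have := h.rho_ne_zero x hx i
    simp only [qOf, map_smul, LinearMap.smul_apply, h1]
    by_cases hij : i = j
    · subst hij; simp; field_simp
    · simp [hij]
  inner_pq i j := by
    have h1 : ∀ α, ambientForm K (e α x) (pd j V x) = 0 := fun α => (h.frame.normal x hx α).2 j
    simp [pOf, qOf, h1]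

theorem p_mem_normalSpace (h : HasPrincipalForms K U V ρ ω e) (hU : IsOpen U) (hx : x ∈ U)
    (i : Fin n) : pOf ω e i x ∈ normalSpace K V x :=
  ⟨(h.isAdaptedFrame hU hx).p_tangent i, fun j => by
    rw [h.pd_eq hx, ← ambientForm_apply, map_smul, (h.isAdaptedFrame hU hx).inner_pq, smul_zero]⟩

theorem inner_q_e (h : HasPrincipalForms K U V ρ ω e) (hx : x ∈ U) (i α : Fin n) :
    ambientForm K (qOf ρ V i x) (e α x) = 0 := by
  have h1 : ambientForm K (e α x) (pd i V x) = 0 := (h.frame.normal x hx α).2 i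
  rw [ambientForm_comm, qOf, map_smul, h1, smul_zero]

theorem smooth_q (h : HasPrincipalForms K U V ρ ω e) (hU : IsOpen U) (i : Fin n) :
    SmoothOn U (qOf ρ V i) :=
  ((h.smooth_rho i).inv fun x hx => h.rho_ne_zero x hx i).smul (SmoothOn.pd h.smooth hU i)

/-- Koszul's argument: the derivatives of the metric in three index orders and the symmetry of
second derivatives determine these products. -/
theorem inner_pd_pd (h : HasPrincipalForms K U V ρ ω e) (hU : IsOpen U) (hx : x ∈ U)
    (i j k : Fin n) : ambientForm K (pd i (pd j V) x) (pd k V x) =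
      (if j = k then ρ j x * pd i (ρ j) x else 0) + (if i = k then ρ i x * pd j (ρ i) x else 0)
        - (if i = j then ρ i x * pd k (ρ i) x else 0) := by
  have d : ∀ a b c, ambientForm K (pd a (pd b V) x) (pd c V x)
      + ambientForm K (pd a (pd c V) x) (pd b V x)
      = 2 * if b = c then ρ b x * pd a (ρ b) x else 0 := by
    intro a b c
    have hV := fun b => SmoothOn.hasPd (SmoothOn.pd h.smooth hU b) hU hx a
    have hb := SmoothOn.hasPd (h.smooth_rho b) hU hx a
    have := ((hV b).inner (K := K) (hV c)).unique
      (((hb.mul hb).mul (HasPd.const a (if b = c then 1 else 0) x)).congr_on hU hx fun y hy =>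
        (h.first y hy b c).trans (by split_ifs <;> ring))
    rw [ambientForm_comm K (pd a (pd c V) x), this]
    split_ifs <;> ring
  have s := fun a b => SmoothOn.pd_comm h.smooth hU hx a b
  have d1 := d i j k
  have d2 := d j i k
  have d3 := d k i j
  rw [s j i] at d2
  rw [s k i, s k j] at d3
  linarith

/-- Weingarten's formula: e_α is parallel, so its derivative is tangential to the immersion, and
differentiating ⟨∂_i V, e_α⟩ = 0 expresses it by the second fundamental form. -/
theorem hasPd_e (h : HasPrincipalForms K U V ρ ω e) (hK : K * K * K = K) (hU : IsOpen U)
    (hx : x ∈ U) (j α : Fin n) : HasPd j (e α) (-(ω x j α • qOf ρ V j x)) x := by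
  have hA := h.isAdaptedFrame hU hx
  have he := SmoothOn.hasPd (h.frame.smooth α) hU hx j
  refine he.cast (eq_neg_of_add_eq_zero_left (hA.eq_zero ?_ (fun i => ?_) fun i => ?_))
  · have h1 := pd_mem_tangent hK hU hx (SmoothOn.hasPd h.smooth hU hx j) h.mem he
      fun y hy => (h.frame.normal y hy α).1
    rw [h.pd_eq hx, map_smul, LinearMap.smul_apply, h.inner_q_e hx, smul_zero, mul_zero, zero_smul,
      add_zero] at h1
    exact (tangentSubmodule K (V x)).add_mem h1
      ((tangentSubmodule K (V x)).smul_mem _ (hA.q_tangent j))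
  · have h1 : ambientForm K (pd j (e α) x) (pOf ω e i x) = 0 :=
      h.frame.parallel x hx α j _ (h.p_mem_normalSpace hU hx i)
    rw [map_add, map_smul, hA.inner_pq, ambientForm_comm, h1, smul_zero, add_zero]
  · have hV := SmoothOn.hasPd (SmoothOn.pd h.smooth hU i) hU hx j
    have h1 := (hV.inner (K := K) he).unique
      ((HasPd.const j (0 : ℝ) x).congr_on hU hx fun y hy => by
      rw [h.pd_eq hy, map_smul, LinearMap.smul_apply, h.inner_q_e hy, smul_zero])
    rw [ambientForm_apply K (pd j (pd i V) x), h.second x hx, h.pd_eq hx, map_smul,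
      LinearMap.smul_apply, smul_eq_mul] at h1
    rw [map_add, map_smul, hA.inner_qq, smul_eq_mul]
    apply mul_left_cancel₀ (h.rho_ne_zero x hx i)
    by_cases hij : i = j
    · subst hij
      simp only [if_true] at h1 ⊢
      linear_combination h1
    · simp only [if_neg hij, if_neg (Ne.symm hij)] at h1 ⊢
      linear_combination h1

theorem hasPd_q (h : HasPrincipalForms K U V ρ ω e) (hU : IsOpen U) (hx : x ∈ U) (i j : Fin n) :
    HasPd j (qOf ρ V i) ((-pd j (ρ i) x / ρ i x ^ 2) • (ρ i x • qOf ρ V i x)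
      + (ρ i x)⁻¹ • pd j (pd i V) x) x := by
  rw [← h.pd_eq hx]
  exact ((SmoothOn.hasPd (h.smooth_rho i) hU hx j).inv (h.rho_ne_zero x hx i)).smul
    (SmoothOn.hasPd (SmoothOn.pd h.smooth hU i) hU hx j)

theorem inner_p_pd_q (h : HasPrincipalForms K U V ρ ω e) (hU : IsOpen U) (hx : x ∈ U)
    (i j k : Fin n) : ambientForm K (pOf ω e k x) (pd j (qOf ρ V i) x) =
      if i = j then (if k = j then 1 else 0) else 0 := by
  have hA := h.isAdaptedFrame hU hx
  have h1 : ambientForm K (pOf ω e k x) (pd j (pd i V) x)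
      = if i = j then ρ i x * (if k = j then 1 else 0) else 0 := by
    have h2 : ∀ α, ambientForm K (e α x) (pd j (pd i V) x) = _ := fun α => by
      rw [ambientForm_comm, ambientForm_apply, h.second x hx]
    rw [← sum_mul_of_mem_orthogonalGroup' (h.orthogonal x hx) k j]
    by_cases hij : i = j
    · subst hij
      simp only [pOf, map_sum, map_smul, LinearMap.sum_apply, LinearMap.smul_apply, h2, if_true,
        smul_eq_mul, Finset.mul_sum]
      exact Finset.sum_congr rfl fun α _ => by ring
    · simp [pOf, h2, hij, Ne.symm hij]
  rw [(h.hasPd_q hU hx i j).eq, map_add, map_smul, map_smul, map_smul, hA.inner_pq, h1]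
  have := h.rho_ne_zero x hx i
  by_cases hij : i = j
  · simp [hij, h.rho_ne_zero x hx j]
  · simp [hij]

theorem pd_q_add_mem (h : HasPrincipalForms K U V ρ ω e) (hK : K * K * K = K) (hU : IsOpen U)
    (hx : x ∈ U) (i j : Fin n) : pd j (qOf ρ V i) x
      + (K * if i = j then ρ j x else 0) • V x ∈ spaceFormTangent K (V x) := by
  have h1 := pd_mem_tangent hK hU hx (SmoothOn.hasPd h.smooth hU hx j) h.mem (h.hasPd_q hU hx i j)
    fun y hy => (h.isAdaptedFrame hU hy).q_tangent i
  rw [← (h.hasPd_q hU hx i j).eq, h.pd_eq hx, map_smul, LinearMap.smul_apply,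
    (h.isAdaptedFrame hU hx).inner_qq] at h1
  convert h1 using 3
  by_cases hij : i = j
  · simp [hij]
  · simp [hij, Ne.symm hij]

/-- For i ≠ j the diagonal fundamental forms leave no component along p or V; the tangential one
comes from the Koszul products. -/
theorem hasPd_q_offdiag (h : HasPrincipalForms K U V ρ ω e) (hK : K * K * K = K) (hU : IsOpen U)
    (hx : x ∈ U) {i j : Fin n} (hij : i ≠ j) :
    HasPd j (qOf ρ V i) (-(gammaOf ρ j i x • qOf ρ V j x)) x := by
  have hA := h.isAdaptedFrame hU hx
  have hq := h.hasPd_q hU hx i j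
  refine ⟨hq.1, eq_neg_of_add_eq_zero_left (hA.eq_zero ?_ (fun k => ?_) fun k => ?_)⟩
  · have h1 := h.pd_q_add_mem hK hU hx i j
    rw [if_neg hij, mul_zero, zero_smul, add_zero] at h1
    exact (tangentSubmodule K (V x)).add_mem h1
      ((tangentSubmodule K (V x)).smul_mem _ (hA.q_tangent j))
  · rw [map_add, h.inner_p_pd_q hU hx, if_neg hij, map_smul, hA.inner_pq, smul_zero, add_zero]
  · have h1 := h.inner_pd_pd hU hx j i k
    rw [h.pd_eq hx k, map_smul, smul_eq_mul, ambientForm_comm, if_neg (Ne.symm hij)] at h1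
    rw [hq.eq, map_add, map_add, map_smul, map_smul, map_smul, map_smul, hA.inner_qq, hA.inner_qq,
      gammaOf, if_neg (Ne.symm hij)]
    have hi := h.rho_ne_zero x hx i
    have hk := h.rho_ne_zero x hx k
    apply mul_left_cancel₀ hk
    simp only [smul_eq_mul]
    have h2 : ∀ t s : ℝ, ρ k x * (t + (ρ i x)⁻¹ * ambientForm K (qOf ρ V k x) (pd j (pd i V) x) + s)
        = ρ k x * t + (ρ i x)⁻¹ * (ρ k x * ambientForm K (qOf ρ V k x) (pd j (pd i V) x))
          + ρ k x * s := by intro t s; ring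
    rw [h2, h1]
    by_cases hki : k = i
    · subst hki
      simp [hij, Ne.symm hij]
      field_simp
      ring
    · by_cases hkj : k = j
      · subst hkj
        simp [hij, Ne.symm hij]
        field_simp
        ring
      · simp [hki, hkj, Ne.symm hki, Ne.symm hkj]

theorem hasRotPd_q (h : HasPrincipalForms K U V ρ ω e) (hK : K * K * K = K) (hU : IsOpen U)
    (hx : x ∈ U) (j : Fin n) : HasRotPd (fun i k => gammaOf ρ k i) j (qOf ρ V)
      ((1 : ℝ) • pOf ω e j x - (K * ρ j x) • V x) x := by
  have hA := h.isAdaptedFrame hU hx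
  have hq := fun i => SmoothOn.hasPd (h.smooth_q hU i) hU hx j
  refine .of_cases (if_pos rfl) ⟨(hq j).1, ?_⟩ fun i hi => h.hasPd_q_offdiag hK hU hx hi
  rw [Finset.sum_erase _ (by simp [gammaOf]), one_smul]
  rw [show ∀ A B C D : Ambient n, (A = B + (C - D)) ↔ (A + D - B - C = 0) by
    intro A B C D; rw [← sub_eq_zero]; constructor <;> intro h <;> rw [← h] <;> abel]
  refine hA.eq_zero ?_ (fun k => ?_) fun k => ?_
  · have h1 := h.pd_q_add_mem hK hU hx j j
    rw [if_pos rfl] at h1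
    exact (tangentSubmodule K (V x)).sub_mem ((tangentSubmodule K (V x)).sub_mem h1
      ((tangentSubmodule K (V x)).sum_mem fun i _ =>
        (tangentSubmodule K (V x)).smul_mem _ (hA.q_tangent i))) (hA.p_tangent j)
  · have hr := mul_ambientForm_of_tangent (hA.p_tangent k)
    rw [ambientForm_comm] at hr
    simp only [map_sub, map_add, map_smul, map_sum, h.inner_p_pd_q hU hx, hA.inner_pq, hA.inner_pp,
      smul_eq_mul, mul_zero, Finset.sum_const_zero, if_true]
    linear_combination ρ j x * hr
  · have hr := mul_ambientForm_of_tangent (hA.q_tangent k)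
    rw [ambientForm_comm] at hr
    -- Orthonormality transfers the off-diagonal equations to the diagonal one: ⟨q_k, ∂_j q_j⟩ =
    -- -⟨q_j, ∂_j q_k⟩ = γ_jk for k ≠ j.
    have h1 := ((hq j).inner (K := K) (hq k)).unique
      ((HasPd.const j (if j = k then 1 else 0) x).congr_on hU hx fun y hy =>
        (h.isAdaptedFrame hU hy).inner_qq j k)
    have h2 : ambientForm K (qOf ρ V k x) (pd j (qOf ρ V j) x) = gammaOf ρ j k x := by
      rw [ambientForm_comm]
      by_cases hk : k = j
      · subst hk
        rw [ambientForm_comm K (qOf ρ V k x)] at h1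
        rw [gammaOf, if_pos rfl]
        linarith
      · rw [(h.hasPd_q_offdiag hK hU hx hk).eq, map_neg, map_smul, hA.inner_qq, if_pos rfl,
          smul_eq_mul] at h1
        linarith
    simp only [map_sub, map_add, map_smul, map_sum, h2, hA.inner_qp, hA.inner_qq,
      smul_eq_mul, mul_ite, mul_one, mul_zero, Finset.sum_ite_eq, Finset.mem_univ, if_true]
    linear_combination ρ j x * hr

theorem hasRotPd_omega (h : HasPrincipalForms K U V ρ ω e) (hK : K * K * K = K) (hU : IsOpen U)
    (hx : x ∈ U) (j α : Fin n) : HasRotPd (gammaOf ρ) j (fun i y => ω y i α) 0 x := by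
  have hA := h.isAdaptedFrame hU hx
  have dω := fun i α k => SmoothOn.hasPd (h.smooth_omega i α) hU hx k
  have off : ∀ i α, i ≠ j → HasPd j (fun y => ω y i α) (-(gammaOf ρ i j x * ω x j α)) x := by
    intro i α hij
    have h1 : HasPd j (pd i (e α)) _ x := (((dω i α j).smul
      (h.hasPd_q_offdiag hK hU hx hij)).neg).congr_on hU hx fun y hy => (h.hasPd_e hK hU hy i α).eq
    have h2 : HasPd i (pd j (e α)) _ x := (((dω j α i).smul
      (h.hasPd_q_offdiag hK hU hx hij.symm)).neg).congr_on hU hx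
        fun y hy => (h.hasPd_e hK hU hy j α).eq
    -- The q_i component of ∂_j∂_i e_α = ∂_i∂_j e_α, that is, the Codazzi equation.
    have h3 := congrArg (ambientForm K (qOf ρ V i x)) (h1.eq.symm.trans
      ((SmoothOn.pd_comm (h.frame.smooth α) hU hx j i).trans h2.eq))
    simp [hA.inner_qq, hij] at h3
    refine (dω i α j).cast ?_
    linear_combination -h3
  refine .of_cases (if_pos rfl) ?_ fun i hi => off i α hi
  -- The rows of ω are orthonormal, so the off-diagonal equations determine the components of ∂_j
  -- ω_j along all rows; expanding in the rows recovers ∂_j ω_j.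
  have hT : ∀ k, ∑ β, pd j (fun y => ω y j β) x * ω x k β = gammaOf ρ k j x := by
    intro k
    have h1 := (HasPd.sum (s := Finset.univ) fun β _ => (dω j β j).mul (dω k β j)).unique
      ((HasPd.const j (if j = k then 1 else 0) x).congr_on hU hx fun y hy =>
        sum_mul_of_mem_orthogonalGroup' (h.orthogonal y hy) j k)
    rw [Finset.sum_add_distrib] at h1
    by_cases hk : k = j
    · subst hk
      rw [gammaOf, if_pos rfl]
      simp only [mul_comm (ω x k _)] at h1
      linarith
    · simp only [(off k _ hk).eq] at h1
      have h2 := sum_mul_of_mem_orthogonalGroup' (h.orthogonal x hx) j j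
      have h3 : ∑ β, ω x j β * -(gammaOf ρ k j x * ω x j β)
          = -(gammaOf ρ k j x) * ∑ β, ω x j β * ω x j β := by
        rw [Finset.mul_sum]
        exact Finset.sum_congr rfl fun β _ => by ring
      rw [h3, h2, if_pos rfl] at h1
      linarith
  refine (dω j α j).cast ?_
  rw [Finset.sum_erase _ (by simp [gammaOf]), add_zero]
  simp only [← hT, smul_eq_mul, Finset.sum_mul]
  rw [Finset.sum_comm]
  simp only [mul_assoc, ← Finset.mul_sum, sum_mul_of_mem_orthogonalGroup (h.orthogonal x hx)]
  simp

theorem hasRotPd_p (h : HasPrincipalForms K U V ρ ω e) (hK : K * K * K = K) (hU : IsOpen U)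
    (hx : x ∈ U) (j : Fin n) :
    HasRotPd (gammaOf ρ) j (pOf ω e) (-((1 : ℝ) • qOf ρ V j x)) x := by
  intro i
  refine HasPd.cast (HasPd.sum fun α _ =>
    (h.hasRotPd_omega hK hU hx j α i).smul (h.hasPd_e hK hU hx j α)) ?_
  have h1 := sum_mul_of_mem_orthogonalGroup' (h.orthogonal x hx) i j
  rw [Finset.sum_add_distrib]
  have h2 : ∑ α, ω x i α • -(ω x j α • qOf ρ V j x)
      = -((if i = j then (1 : ℝ) else 0) • qOf ρ V j x) := by
    rw [← h1, Finset.sum_smul, ← Finset.sum_neg_distrib]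
    exact Finset.sum_congr rfl fun α _ => by module
  rw [h2]
  simp only [pOf, Finset.smul_sum, smul_smul]
  by_cases hij : i = j
  · subst hij
    simp only [if_true, add_zero, add_smul, neg_smul, smul_eq_mul, Finset.sum_add_distrib,
      Finset.sum_neg_distrib, Finset.sum_smul]
    rw [Finset.sum_comm, add_assoc]
  · simp [hij, neg_smul]

theorem isMovingFrame (h : HasPrincipalForms K U V ρ ω e) (hK : K * K * K = K) (hU : IsOpen U) :
    IsMovingFrame K U ρ (gammaOf ρ) (pOf ω e) (qOf ρ V) V :=
  .of_isAdaptedFrame (.of_hasRotPd (fun _ _ _ => if_pos rfl)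
    (fun i => ContDiffOn.sum fun α _ => (h.smooth_omega i α).smul (h.frame.smooth α))
    (h.smooth_q hU) h.smooth (fun _ hx => h.hasRotPd_p hK hU hx)
    (fun _ hx => h.hasRotPd_q hK hU hx)
    fun _ hx j => SmoothOn.hasPd_of_eq h.smooth hU hx (h.pd_eq hx j))
    fun _ hx => h.isAdaptedFrame hU hx

theorem omegaSystem (h : HasPrincipalForms K U V ρ ω e) (hK : K * K * K = K) (hU : IsOpen U) :
    OmegaSystem U (gammaOf ρ) ω :=
  .of_hasRotPd (fun _ _ _ => if_pos rfl) h.smooth_omega h.orthogonal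
    fun _ hx => h.hasRotPd_omega hK hU hx

theorem smooth_gammaOf (h : HasPrincipalForms K U V ρ ω e) (hU : IsOpen U) (i j : Fin n) :
    SmoothOn U (gammaOf ρ i j) := by
  by_cases hij : i = j
  · exact (contDiffOn_const (c := (0 : ℝ))).congr fun _ _ => if_pos hij
  · exact ((SmoothOn.pd (h.smooth_rho i) hU j).div (h.smooth_rho j)
      fun x hx => h.rho_ne_zero x hx j).neg.congr fun x _ => if_neg hij

theorem gaussCodazzi (h : HasPrincipalForms K U V ρ ω e) (hK : K * K * K = K) (hU : IsOpen U) :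
    GaussCodazzi K U ρ (gammaOf ρ) :=
  (h.isMovingFrame hK hU).gaussCodazzi hU h.smooth_rho (h.smooth_gammaOf hU)
    (fun _ _ _ => if_pos rfl) fun x hx i j hij => by
      rw [gammaOf, if_neg hij, neg_mul, div_mul_cancel₀ _ (h.rho_ne_zero x hx j), add_neg_cancel]

end HasPrincipalForms

end Principal

end SpaceFormDarboux

/-! ### The main theorem -/

theorem mainTheorem3 {n : ℕ} {K : ℝ} (hK : K = 0 ∨ K = 1 ∨ K = -1) {U : Set (Coord n)}
    (hU : IsOpen U) :
    -- an immersion in principal coordinates gives a solution of all the equations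
    (∀ (V : Coord n → Ambient n) (ρ : Fin n → Coord n → ℝ)
        (ω : Coord n → Matrix (Fin n) (Fin n) ℝ) (e : Fin n → Coord n → Ambient n),
        HasPrincipalForms K U V ρ ω e →
          GaussCodazzi K U ρ (gammaOf ρ) ∧ OmegaSystem U (gammaOf ρ) ω ∧
            IsMovingFrame K U ρ (gammaOf ρ) (pOf ω e) (qOf ρ V) V) ∧
    -- the transformation
    ∀ (μ : ℝ) (ρ : Fin n → Coord n → ℝ) (γ : Fin n → Fin n → Coord n → ℝ)
      (ξ η : Fin n → Coord n → ℝ) (ζ : Coord n → ℝ),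
      GaussCodazzi K U ρ γ → IsDarbouxData K U ρ γ μ ξ η ζ →
      -- new solution of the Gauss-Codazzi equations
      GaussCodazzi K U (rhoT μ ξ ζ ρ) (gammaT μ ξ η γ) ∧
      (∀ ω : Coord n → Matrix (Fin n) (Fin n) ℝ, OmegaSystem U γ ω →
        OmegaSystem U (gammaT μ ξ η γ) (omegaT ξ ω) ∧
        (μ ≠ 0 → ∀ x ∈ U, ∀ i α, ((omegaT ξ ω x i α : ℝ) : ℂ) =
          ∑ j, geoDarboux K μ ξ η ζ 0 x (Sum.inl i) (Sum.inl j) * ((ω x j α : ℝ) : ℂ))) ∧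
      ∀ (p q : Fin n → Coord n → Ambient n) (r : Coord n → Ambient n),
        IsMovingFrame K U ρ γ p q r →
        -- the new frame is `G(1)` applied to the old one
        (∀ x ∈ U, ∀ (a : Idx n) (c : Fin (2 * n + 1)),
          ((column (fun i => pT K μ ξ η ζ p q r i x) (fun i => qT K μ ξ η ζ p q r i x)
              (rT K μ ξ η ζ p q r x) a c : ℝ) : ℂ) =
            ∑ b, geoDarboux K μ ξ η ζ 1 x a b *
              ((column (fun i => p i x) (fun i => q i x) (r x) b c : ℝ) : ℂ)) ∧
        -- new solution of the structure equations
        IsMovingFrame K U (rhoT μ ξ ζ ρ) (gammaT μ ξ η γ)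
          (pT K μ ξ η ζ p q r) (qT K μ ξ η ζ p q r) (rT K μ ξ η ζ p q r) ∧
        -- the new immersion
        (∀ ω : Coord n → Matrix (Fin n) (Fin n) ℝ, OmegaSystem U γ ω →
          HasPrincipalForms K {x ∈ U | ∀ i, rhoT μ ξ ζ ρ i x ≠ 0} (rT K μ ξ η ζ p q r)
              (rhoT μ ξ ζ ρ) (omegaT ξ ω) (normalOf (omegaT ξ ω) (pT K μ ξ η ζ p q r)) ∧
            IsSpaceFormImmersion K {x ∈ U | ∀ i, rhoT μ ξ ζ ρ i x ≠ 0}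
              (rT K μ ξ η ζ p q r)) ∧
        -- the new position vector in terms of the old one
        (∀ x ∈ U, (∀ i, ρ i x ≠ 0) →
          rT K μ ξ η ζ p q r x = positionT K μ ξ η ζ ρ r x) := by
  have hK3 : K * K * K = K := by rcases hK with rfl | rfl | rfl <;> norm_num
  refine ⟨fun V ρ ω e h => ⟨h.gaussCodazzi hK3 hU, h.omegaSystem hK3 hU, h.isMovingFrame hK3 hU⟩,
    fun μ ρ γ ξ η ζ hG hD => ?_⟩
  have hG' := gaussCodazzi_transform hU hG hD
  refine ⟨hG', fun ω hω => ⟨omegaSystem_transform hU hG hD hω, fun hμ x hx i α =>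
    omegaT_eq_geoDarboux hD hx hμ ω i α⟩, fun p q r hF => ?_⟩
  have hF' := isMovingFrame_transform hK3 hU hG hD hF
  refine ⟨fun x hx a c => frameT_eq_geoDarboux hD hx a c, hF', fun ω hω => ?_,
    fun x hx hρ => rT_eq_positionT hU hG hF.structure_eq hx hρ⟩
  have hW := isOpen_setOf_forall_ne_zero hU hG'.smooth_rho
  have hs : {x ∈ U | ∀ i, rhoT μ ξ ζ ρ i x ≠ 0} ⊆ U := fun x hx => hx.1
  have hω' := (omegaSystem_transform hU hG hD hω).mono hs
  exact ⟨(hF'.mono hs).hasPrincipalForms hW (hG'.mono hs) hω' fun x hx => hx.2,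
    (hF'.mono hs).isSpaceFormImmersion hW (hG'.mono hs) hω' fun x hx => hx.2⟩
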